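/- Let $\Omega=(0,1)$, $\alpha>0$, $u_d\in L^\infty(\Omega)$, $a\in C^{0,1}([0,1])$ with $a(x)\ge\nu>0$ for all $x\in[0,1]$, and $d_0\in L^\infty(\Omega)$ with $d_0\ge 0$ a.e. Let $V=H^1_0(\Omega)$, $Q=BV(\Omega)$ and $\mathfrak a(v,w)=\int_\Omega a v'w'\,dx+\int_\Omega d_0 v w\,dx$ for $v,w\in V$. Write $(\cdot,\cdot)$ for the $L^2(\Omega)$ inner product and $\|q'\|_{\mathcal M(\Omega)}$ for the total variation of the distributional derivative of $q\in Q$. Let $(\bar u,\bar q)\in V\times Q$ be the solution of $$\min_{(u,q)\in V\times Q}\ \tfrac12\|u-u_d\|_{L^2(\Omega)}^2+\alpha\|q'\|_{\mathcal M(\Omega)}\quad\text{s.t.}\quad \mathfrak a(u,w)=(q,w)\ \ \forall w\in V .$$ Let $\bar z\in V$ be the adjoint state, i.e. $\mathfrak a(w,\bar z)=(w,\bar u-u_d)$ for all $w\in V$ (so that $\bar z\in W^{2,\infty}(\Omega)\subset C^1([0,1])$), and let $\bar\Phi(x)=\int_0^x\bar z(s)\,ds$ for $x\in[0,1]$. Assume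 that the set $\{x\in\Omega:\ |\bar\Phi(x)|=\alpha\}$ is finite (possibly empty) and that $\bar z'(x)\neq 0$ at each of its points. For a mesh $0=x_0<x_1<\dots<x_l=1$ with $l>1$ and mesh width $h=\max_{1\le i\le l}(x_i-x_{i-1})$, let $V_h$ be the space of continuous functions on $[0,1]$ that vanish at $0$ and $1$ and are affine on each interval $(x_{i-1},x_i)$, and let $(\bar u_h,\bar q_h)\in V_h\times Q$ be the solution of the variationally discretized problem $$\min_{(u_h,q)\in V_h\times Q}\ \tfrac12\|u_h-u_d\|_{L^2(\Omega)}^2+\alpha\|q'\|_{\mathcal M(\Omega)}\quad\text{s.t.}\quad \mathfrak a(u_h,w_h)=(q,w_h)\ \ \forall w_h\in V_h .$$ Then there exist constants $C,h_0>0$, independent of the mesh, such that for every mesh with width $h\in(0,h_0]$ $$\|\bar u_h-\bar u\|_{L^2(\Omega)}\le C h^2 .$$ -/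

import Mathlib

open MeasureTheory
open scoped ContDiff ENNReal NNReal

namespace BVControl

noncomputable section

/-- The spatial domain `Ω = (0,1)`. -/
def Ω : Set ℝ := Set.Ioo 0 1

/-- Lebesgue measure on `Ω`. -/
def lebΩ : Measure ℝ := volume.restrict Ω

/-- The `L²(Ω)` norm. -/
def l2norm (f : ℝ → ℝ) : ℝ := (eLpNorm f 2 lebΩ).toReal

/-- The `L²(Ω)` pairing `(f, g) = ∫_Ω f g`. -/
def l2pair (f g : ℝ → ℝ) : ℝ := ∫ x, f x * g x ∂lebΩ

/-- Test functions `φ ∈ C_c^∞(Ω)` (extended by zero). -/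
structure IsTestFun (φ : ℝ → ℝ) : Prop where
  smooth : ContDiff ℝ ∞ φ
  compact : HasCompactSupport φ
  support : tsupport φ ⊆ Ω

/-- `dv` is the weak derivative of `v` on `Ω`. -/
def HasWeakDeriv (v dv : ℝ → ℝ) : Prop :=
  ∀ φ : ℝ → ℝ, IsTestFun φ → l2pair v (deriv φ) = -l2pair dv φ

/-- `v ∈ V = H¹₀(Ω)`, with weak derivative `dv`: both are square integrable, `dv` is the weak
derivative of `v`, and `v` is in the closure of `C_c^∞(Ω)` with respect to the `H¹(Ω)` norm. -/
structure IsH10 (v dv : ℝ → ℝ) : Prop where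
  memLp : MemLp v 2 lebΩ
  memLp_deriv : MemLp dv 2 lebΩ
  weakDeriv : HasWeakDeriv v dv
  approx : ∀ ε : ℝ, 0 < ε → ∃ φ : ℝ → ℝ, IsTestFun φ ∧
    l2norm (fun x => v x - φ x) < ε ∧ l2norm (fun x => dv x - deriv φ x) < ε

/-- The total variation `‖q'‖_{M(Ω)} ∈ [0, ∞]` of the distributional derivative of `q ∈ L¹(Ω)`:
the supremum of `∫_Ω q φ'` over all test functions with `|φ| ≤ 1`. -/
def totalVar (q : ℝ → ℝ) : ℝ≥0∞ :=
  ⨆ (φ : ℝ → ℝ) (_ : IsTestFun φ ∧ ∀ x, |φ x| ≤ 1), ENNReal.ofReal (l2pair q (deriv φ))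

/-- `q ∈ Q = BV(Ω)`. -/
structure MemBV (q : ℝ → ℝ) : Prop where
  integrable : Integrable q lebΩ
  totalVar_lt_top : totalVar q < ⊤

/-- The bilinear form `𝔞(v, w) = (a v', w') + (d₀ v, w)`; `dv`, `dw` are the weak derivatives
of `v`, `w`. -/
def bform (a d₀ v dv w dw : ℝ → ℝ) : ℝ :=
  l2pair (fun x => a x * dv x) dw + l2pair (fun x => d₀ x * v x) w

/-- The objective `J(u, q) = ½ ‖u - u_d‖² + α ‖q'‖_{M(Ω)}` (finite for `q ∈ BV(Ω)`). -/
def objective (α : ℝ) (u_d u q : ℝ → ℝ) : ℝ :=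
  1 / 2 * l2norm (fun x => u x - u_d x) ^ 2 + α * (totalVar q).toReal

/-- `u ∈ V` is the state associated with `q`: `𝔞(u, w) = (q, w)` for all `w ∈ V`. -/
def IsState (a d₀ q u : ℝ → ℝ) : Prop :=
  ∃ du : ℝ → ℝ, IsH10 u du ∧
    ∀ w dw : ℝ → ℝ, IsH10 w dw → bform a d₀ u du w dw = l2pair q w

/-- `q` is an optimal control of the continuous problem, with associated optimal state `u`. -/
structure IsOptimal (α : ℝ) (a d₀ u_d q u : ℝ → ℝ) : Prop where
  memBV : MemBV q
  state : IsState a d₀ q u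
  minimal : ∀ q' u' : ℝ → ℝ, MemBV q' → IsState a d₀ q' u' →
    objective α u_d u q ≤ objective α u_d u' q'

/-- `z ∈ V` is the adjoint state associated with `u`: `𝔞(w, z) = (w, u - u_d)` for all `w ∈ V`.
As usual `z` denotes the continuous representative on `[0,1]`, so that point values make sense. -/
def IsAdjointState (a d₀ u_d u z : ℝ → ℝ) : Prop :=
  ContinuousOn z (Set.Icc 0 1) ∧
  ∃ dz : ℝ → ℝ, IsH10 z dz ∧
    ∀ w dw : ℝ → ℝ, IsH10 w dw → bform a d₀ w dw z dz = l2pair w (fun x => u x - u_d x)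

/-- The multiplier `Φ(x) = ∫₀ˣ z(s) ds`. -/
def multiplier (z : ℝ → ℝ) (x : ℝ) : ℝ := ∫ s in (0 : ℝ)..x, z s

/-- The set of all `x ∈ Ω` with `|Φ(x)| = α`. -/
def contactSet (α : ℝ) (z : ℝ → ℝ) : Set ℝ := {x ∈ Ω | |multiplier z x| = α}

/-- The structural assumption: `{x ∈ Ω : |Φ(x)| = α}` is finite and `z' ≠ 0` on this set. -/
structure StructuralAssumption (α : ℝ) (z : ℝ → ℝ) : Prop where
  finite : (contactSet α z).Finite
  deriv_ne_zero : ∀ x ∈ contactSet α z, deriv z x ≠ 0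

/-- A partition `0 = x_0 < x_1 < ⋯ < x_l = 1` of `[0,1]` into `l > 1` subintervals. -/
structure Mesh where
  l : ℕ
  one_lt : 1 < l
  node : Fin (l + 1) → ℝ
  strictMono : StrictMono node
  node_zero : node 0 = 0
  node_last : node (Fin.last l) = 1

/-- The cell `T_i`, an open interval between consecutive nodes. -/
def Mesh.cell (M : Mesh) (i : Fin M.l) : Set ℝ := Set.Ioo (M.node i.castSucc) (M.node i.succ)

/-- The mesh width, the largest length of a cell. -/
def Mesh.width (M : Mesh) : ℝ := ⨆ i : Fin M.l, (M.node i.succ - M.node i.castSucc)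

/-- `v ∈ V_h`, with weak derivative `dv`: `v ∈ V` is continuous on `[0,1]`, vanishes at the end
points and is affine on every cell. -/
structure IsFE (M : Mesh) (v dv : ℝ → ℝ) : Prop where
  isH10 : IsH10 v dv
  continuousOn : ContinuousOn v (Set.Icc 0 1)
  zero_left : v 0 = 0
  zero_right : v 1 = 0
  affine : ∀ i : Fin M.l, ∃ m c : ℝ, ∀ x ∈ M.cell i, v x = m * x + c

/-- `u ∈ V_h` is the discrete state associated with `q`:
`𝔞(u, w) = (q, w)` for all `w ∈ V_h`. -/
def IsDiscreteState (a d₀ : ℝ → ℝ) (M : Mesh) (q u : ℝ → ℝ) : Prop :=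
  ∃ du : ℝ → ℝ, IsFE M u du ∧
    ∀ w dw : ℝ → ℝ, IsFE M w dw → bform a d₀ u du w dw = l2pair q w

/-- `q ∈ BV(Ω)` is an optimal control of the variationally discretized problem on the mesh `M`
(states in `V_h`, controls not discretized), with associated optimal state `u ∈ V_h`. -/
structure IsDiscreteOptimal (α : ℝ) (a d₀ u_d : ℝ → ℝ) (M : Mesh) (q u : ℝ → ℝ) : Prop where
  memBV : MemBV q
  state : IsDiscreteState a d₀ M q u
  minimal : ∀ q' u' : ℝ → ℝ, MemBV q' → IsDiscreteState a d₀ M q' u' →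
    objective α u_d u q ≤ objective α u_d u' q'

end

end BVControl

namespace BVControl

noncomputable section

/-! ### Lebesgue measure on `Ω` and primitives -/

/-! Write Φ for the multiplier, z for the adjoint state and G(q) = (q, z) + α tv q. Optimality of q̄
gives G ≥ 0 on BV and G(q̄) ≤ 0 (`first_order`), hence Φ(1) = 0 and |Φ| ≤ α (`multiplier_bounds`).
At a contact point Φ' = z vanishes while z' does not, so α - |Φ| grows at least quadratically away
from the contact points (`exists_growth`).

The core is a quantitative form of "controls jump only at contact points". Let P be cell averaging
on a fixed mesh `M₀` whose nodes include all contact points. Then ‖q - Pq‖_{L¹} ≤ ε tv q + G(q)/(cε)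
for every q in BV and ε > 0 (`integral_abs_sub_avg_le`), by duality with functions whose primitive
vanishes at the nodes. For q̄ the limit ε → 0 gives q̄ = Pq̄, so q̄ is bounded, the state and the
adjoint state have Lipschitz derivatives, and their Ritz projections converge at rate h² in the
maximum norm (`exists_ritz_le`).

Let p = q_h - q̄ and let v be u_h minus the Ritz projection of the state, which is the discrete
state of p. Testing the discrete optimality condition with q̄ and using G(q̄) ≤ 0 yields G(q_h) +
‖v‖² ≤ Ch²(‖p‖_{L¹} + ‖v‖) (`exists_energy_le`). The part Pp is seen by finitely many fixed test
functions, so ‖p‖_{L¹} ≤ C(‖p - Pp‖_{L¹} + ‖v‖ + h²‖p‖_{L¹}) (`exists_integral_abs_le`), and p - Pp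
= q_h - Pq_h. Since tv q_h is bounded uniformly in the mesh, taking ε proportional to h² in the core
estimate makes G(q_h) cancel and leaves ‖v‖² ≤ Ch⁴ + Ch²‖v‖ (`le_of_basic_estimates`). -/

lemma lebΩ_eq_Ioc : lebΩ = volume.restrict (Set.Ioc 0 1) :=
  Measure.restrict_congr_set Ioo_ae_eq_Ioc

instance : IsProbabilityMeasure lebΩ := ⟨by simp [lebΩ, Ω]⟩

lemma intervalIntegral_eq (f : ℝ → ℝ) : ∫ x in (0 : ℝ)..1, f x = ∫ x, f x ∂lebΩ := by
  rw [intervalIntegral.integral_of_le zero_le_one, lebΩ_eq_Ioc]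

lemma intervalIntegrable_iff {f : ℝ → ℝ} :
    IntervalIntegrable f volume 0 1 ↔ Integrable f lebΩ := by
  rw [intervalIntegrable_iff_integrableOn_Ioc_of_le zero_le_one, lebΩ_eq_Ioc, IntegrableOn]

lemma ae_mem_Ω : ∀ᵐ x ∂lebΩ, x ∈ Ω := ae_restrict_mem measurableSet_Ioo

lemma Ω_subset_Icc : Ω ⊆ Set.Icc 0 1 := Set.Ioo_subset_Icc_self

lemma ae_mem_Icc : ∀ᵐ x ∂lebΩ, x ∈ Set.Icc (0 : ℝ) 1 :=
  ae_mem_Ω.mono fun _ hx => Ω_subset_Icc hx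

lemma intervalIntegrable_of_mem {f : ℝ → ℝ} (hf : Integrable f lebΩ) {x y : ℝ}
    (hx : x ∈ Set.Icc (0 : ℝ) 1) (hy : y ∈ Set.Icc (0 : ℝ) 1) :
    IntervalIntegrable f volume x y := by
  refine (intervalIntegrable_iff.2 hf).mono_set ?_
  rw [Set.uIcc_of_le (zero_le_one' ℝ)]
  exact Set.uIcc_subset_Icc hx hy

lemma Ioc_subset_of_mem {x y : ℝ} (hx : x ∈ Set.Icc (0 : ℝ) 1) (hy : y ∈ Set.Icc (0 : ℝ) 1) :
    Set.uIoc x y ⊆ Set.Ioc 0 1 :=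
  Set.Ioc_subset_Ioc (le_min hx.1 hy.1) (max_le hx.2 hy.2)

lemma ae_imp_of_ae {p : ℝ → Prop} (h : ∀ᵐ x ∂lebΩ, p x) : ∀ᵐ x, x ∈ Set.Ioc (0 : ℝ) 1 → p x := by
  rw [lebΩ_eq_Ioc] at h
  exact (ae_restrict_iff' measurableSet_Ioc).1 h

/-- The primitive of `k` vanishing at `0`. -/
def prim (k : ℝ → ℝ) (x : ℝ) : ℝ := ∫ s in (0 : ℝ)..x, k s

@[simp] lemma prim_zero (k : ℝ → ℝ) : prim k 0 = 0 := by simp [prim]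

lemma prim_one (k : ℝ → ℝ) : prim k 1 = ∫ x, k x ∂lebΩ := intervalIntegral_eq k

lemma zero_mem_Icc : (0 : ℝ) ∈ Set.Icc (0 : ℝ) 1 := by simp
lemma one_mem_Icc : (1 : ℝ) ∈ Set.Icc (0 : ℝ) 1 := by simp

lemma intervalIntegral_congr_of_ae {k k' : ℝ → ℝ} (h : k =ᵐ[lebΩ] k') {x y : ℝ}
    (hx : x ∈ Set.Icc (0 : ℝ) 1) (hy : y ∈ Set.Icc (0 : ℝ) 1) :
    ∫ s in x..y, k s = ∫ s in x..y, k' s := by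
  refine intervalIntegral.integral_congr_ae ?_
  filter_upwards [ae_imp_of_ae h] with s hs hs'
  exact hs (Ioc_subset_of_mem hx hy hs')

lemma prim_congr {k k' : ℝ → ℝ} (h : k =ᵐ[lebΩ] k') {x : ℝ} (hx : x ∈ Set.Icc (0 : ℝ) 1) :
    prim k x = prim k' x := intervalIntegral_congr_of_ae h zero_mem_Icc hx

lemma prim_sub_prim {k : ℝ → ℝ} (hk : Integrable k lebΩ) {x y : ℝ}
    (hx : x ∈ Set.Icc (0 : ℝ) 1) (hy : y ∈ Set.Icc (0 : ℝ) 1) :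
    prim k y - prim k x = ∫ s in x..y, k s :=
  intervalIntegral.integral_interval_sub_left (intervalIntegrable_of_mem hk zero_mem_Icc hy)
    (intervalIntegrable_of_mem hk zero_mem_Icc hx)

lemma prim_add {k k' : ℝ → ℝ} (hk : Integrable k lebΩ) (hk' : Integrable k' lebΩ) {x : ℝ}
    (hx : x ∈ Set.Icc (0 : ℝ) 1) : prim (fun s => k s + k' s) x = prim k x + prim k' x :=
  intervalIntegral.integral_add (intervalIntegrable_of_mem hk zero_mem_Icc hx)
    (intervalIntegrable_of_mem hk' zero_mem_Icc hx)

lemma prim_sub {k k' : ℝ → ℝ} (hk : Integrable k lebΩ) (hk' : Integrable k' lebΩ) {x : ℝ}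
    (hx : x ∈ Set.Icc (0 : ℝ) 1) : prim (fun s => k s - k' s) x = prim k x - prim k' x :=
  intervalIntegral.integral_sub (intervalIntegrable_of_mem hk zero_mem_Icc hx)
    (intervalIntegrable_of_mem hk' zero_mem_Icc hx)

lemma prim_const_mul (c : ℝ) (k : ℝ → ℝ) (x : ℝ) : prim (fun s => c * k s) x = c * prim k x :=
  intervalIntegral.integral_const_mul c k

lemma abs_prim_le {k : ℝ → ℝ} (hk : Integrable k lebΩ) {x : ℝ} (hx : x ∈ Set.Icc (0 : ℝ) 1) :
    |prim k x| ≤ ∫ s, |k s| ∂lebΩ := by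
  calc |prim k x| ≤ ∫ s in (0 : ℝ)..x, |k s| := by
        exact intervalIntegral.norm_integral_le_integral_norm (f := k) (μ := volume) hx.1
    _ ≤ ∫ s in (0 : ℝ)..1, |k s| := by
        refine intervalIntegral.integral_mono_interval le_rfl hx.1 hx.2
          (Filter.Eventually.of_forall fun s => abs_nonneg _) ?_
        exact intervalIntegrable_iff.2 hk.abs
    _ = _ := intervalIntegral_eq _

lemma abs_prim_sub_prim_le {k : ℝ → ℝ} (hk : Integrable k lebΩ) {B : ℝ}
    (hB : ∀ᵐ x ∂lebΩ, |k x| ≤ B) {x y : ℝ}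
    (hx : x ∈ Set.Icc (0 : ℝ) 1) (hy : y ∈ Set.Icc (0 : ℝ) 1) :
    |prim k y - prim k x| ≤ B * |y - x| := by
  rw [prim_sub_prim hk hx hy]
  refine intervalIntegral.norm_integral_le_of_norm_le_const_ae (f := k) ?_
  filter_upwards [ae_imp_of_ae hB] with s hs hs'
  exact hs (Ioc_subset_of_mem hx hy hs')

lemma prim_ac {k : ℝ → ℝ} (hk : Integrable k lebΩ) :
    AbsolutelyContinuousOnInterval (prim k) 0 1 :=
  (intervalIntegrable_iff.2 hk).absolutelyContinuousOnInterval_intervalIntegral (by simp)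

lemma prim_continuousOn {k : ℝ → ℝ} (hk : Integrable k lebΩ) :
    ContinuousOn (prim k) (Set.Icc 0 1) := by
  simpa using (prim_ac hk).continuousOn

lemma prim_hasDerivAt {k : ℝ → ℝ} (hk : Integrable k lebΩ) :
    ∀ᵐ x ∂lebΩ, HasDerivAt (prim k) (k x) x := by
  rw [lebΩ, Ω, ae_restrict_iff' measurableSet_Ioo]
  filter_upwards [(intervalIntegrable_iff.2 hk).ae_hasDerivAt_integral] with x hx hx'
  exact hx (by simpa using Ω_subset_Icc hx') 0 (by simp)

lemma aesm_of_continuousOn {f : ℝ → ℝ} (hf : ContinuousOn f (Set.Icc 0 1)) :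
    AEStronglyMeasurable f lebΩ :=
  (hf.mono Ω_subset_Icc).aestronglyMeasurable measurableSet_Ioo

lemma exists_bound_of_continuousOn {f : ℝ → ℝ} (hf : ContinuousOn f (Set.Icc 0 1)) :
    ∃ B, 0 ≤ B ∧ ∀ x ∈ Set.Icc (0 : ℝ) 1, |f x| ≤ B := by
  obtain ⟨B, hB⟩ := isCompact_Icc.exists_bound_of_continuousOn hf
  exact ⟨B, (norm_nonneg _).trans (hB 0 zero_mem_Icc), hB⟩

lemma memLp_top_of_continuousOn {f : ℝ → ℝ} (hf : ContinuousOn f (Set.Icc 0 1)) :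
    MemLp f ⊤ lebΩ := by
  obtain ⟨B, -, hB⟩ := exists_bound_of_continuousOn hf
  exact memLp_top_of_bound (aesm_of_continuousOn hf) B (ae_mem_Icc.mono fun x hx => hB x hx)

lemma memLp_top_prim {k : ℝ → ℝ} (hk : Integrable k lebΩ) : MemLp (prim k) ⊤ lebΩ :=
  memLp_top_of_continuousOn (prim_continuousOn hk)

lemma exists_bound_of_memLp_top {f : ℝ → ℝ} (hf : MemLp f ⊤ lebΩ) :
    ∃ B, 0 ≤ B ∧ ∀ᵐ x ∂lebΩ, |f x| ≤ B :=
  ⟨(eLpNormEssSup f lebΩ).toReal, ENNReal.toReal_nonneg, by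
    have hlt : eLpNormEssSup f lebΩ < ⊤ := by simpa using hf.2
    filter_upwards [ae_le_eLpNormEssSup (f := f) (μ := lebΩ)] with x hx
    simpa using ENNReal.toReal_mono hlt.ne hx⟩

lemma integrable_mul_of_bdd {f g : ℝ → ℝ} (hf : MemLp f ⊤ lebΩ) (hg : Integrable g lebΩ) :
    Integrable (fun x => f x * g x) lebΩ := by
  obtain ⟨B, hB0, hB⟩ := exists_bound_of_memLp_top hf
  exact hg.bdd_mul hf.1 hB

lemma memLp_two_mul_of_bdd {f g : ℝ → ℝ} (hf : MemLp f ⊤ lebΩ) (hg : MemLp g 2 lebΩ) :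
    MemLp (fun x => f x * g x) 2 lebΩ := hg.mul hf

lemma _root_.MeasureTheory.MemLp.to_integrable {f : ℝ → ℝ} (hf : MemLp f 2 lebΩ) : Integrable f lebΩ :=
  hf.integrable (by norm_num)

lemma _root_.MeasureTheory.MemLp.top_to_two {f : ℝ → ℝ} (hf : MemLp f ⊤ lebΩ) : MemLp f 2 lebΩ :=
  hf.mono_exponent le_top

/-- Integration by parts for two primitives. -/
lemma integral_prim_mul {k m : ℝ → ℝ} (hk : Integrable k lebΩ) (hm : Integrable m lebΩ) :
    ∫ x, prim k x * m x ∂lebΩ = prim k 1 * prim m 1 - ∫ x, k x * prim m x ∂lebΩ := by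
  have h := (prim_ac hk).integral_mul_deriv_eq_deriv_mul (prim_ac hm)
  rw [intervalIntegral_eq, intervalIntegral_eq] at h
  rw [show ∫ x, prim k x * m x ∂lebΩ = ∫ x, prim k x * deriv (prim m) x ∂lebΩ from
      integral_congr_ae ((prim_hasDerivAt hm).mono fun x hx => by simp [hx.deriv]),
    show ∫ x, k x * prim m x ∂lebΩ = ∫ x, deriv (prim k) x * prim m x ∂lebΩ from
      integral_congr_ae ((prim_hasDerivAt hk).mono fun x hx => by simp [hx.deriv]), h]
  simp

/-- Integration by parts against a Lipschitz function. -/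
lemma abs_integral_mul_lipschitz_le {k F : ℝ → ℝ} {L : ℝ≥0} (hk : Integrable k lebΩ)
    (hk0 : prim k 1 = 0) (hF : LipschitzOnWith L F (Set.Icc 0 1)) :
    |∫ x, k x * F x ∂lebΩ| ≤ L * ∫ x, |prim k x| ∂lebΩ := by
  have hFac : AbsolutelyContinuousOnInterval F 0 1 :=
    LipschitzOnWith.absolutelyContinuousOnInterval (by simpa using hF)
  have h := (prim_ac hk).integral_mul_deriv_eq_deriv_mul hFac
  rw [intervalIntegral_eq, intervalIntegral_eq] at h
  rw [show ∫ x, k x * F x ∂lebΩ = ∫ x, deriv (prim k) x * F x ∂lebΩ from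
      integral_congr_ae ((prim_hasDerivAt hk).mono fun x hx => by simp [hx.deriv])]
  have h2 : ∫ x, deriv (prim k) x * F x ∂lebΩ = -∫ x, prim k x * deriv F x ∂lebΩ := by
    rw [h]; simp [hk0]
  rw [h2, abs_neg, ← integral_const_mul]
  refine norm_integral_le_of_norm_le (f := fun x => prim k x * deriv F x)
    ((memLp_top_prim hk).top_to_two.to_integrable.abs.const_mul _) ?_
  filter_upwards [ae_mem_Ω] with x hx
  rw [norm_mul, mul_comm]
  gcongr
  -- Where `F` is not differentiable, `deriv F` is 0, so the Lipschitz bound holds at every interior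
  -- point.
  · exact norm_deriv_le_of_lipschitzOn (Icc_mem_nhds hx.1 hx.2) hF
  · simp

/-! ### The `L²` norm and pairing -/

lemma l2norm_eq_norm_toLp {f : ℝ → ℝ} (hf : MemLp f 2 lebΩ) : l2norm f = ‖hf.toLp f‖ :=
  (Lp.norm_toLp f hf).symm

lemma l2norm_nonneg (f : ℝ → ℝ) : 0 ≤ l2norm f := ENNReal.toReal_nonneg

lemma l2norm_congr {f g : ℝ → ℝ} (h : f =ᵐ[lebΩ] g) : l2norm f = l2norm g := by
  rw [l2norm, l2norm, eLpNorm_congr_ae h]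

lemma l2pair_congr {f f' g g' : ℝ → ℝ} (h : f =ᵐ[lebΩ] f') (h' : g =ᵐ[lebΩ] g') :
    l2pair f g = l2pair f' g' :=
  integral_congr_ae (h.mul h')

lemma l2pair_comm (f g : ℝ → ℝ) : l2pair f g = l2pair g f := by simp [l2pair, mul_comm]

lemma l2pair_eq_inner {f g : ℝ → ℝ} (hf : MemLp f 2 lebΩ) (hg : MemLp g 2 lebΩ) :
    l2pair f g = inner ℝ (hf.toLp f) (hg.toLp g) := by
  rw [L2.inner_def]
  refine integral_congr_ae ?_
  filter_upwards [hf.coeFn_toLp, hg.coeFn_toLp] with x h1 h2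
  rw [h1, h2]; simp [mul_comm]

lemma abs_l2pair_le {f g : ℝ → ℝ} (hf : MemLp f 2 lebΩ) (hg : MemLp g 2 lebΩ) :
    |l2pair f g| ≤ l2norm f * l2norm g := by
  rw [l2pair_eq_inner hf hg, l2norm_eq_norm_toLp hf, l2norm_eq_norm_toLp hg]
  exact abs_real_inner_le_norm _ _

lemma l2norm_sq {f : ℝ → ℝ} (hf : MemLp f 2 lebΩ) : l2norm f ^ 2 = l2pair f f := by
  rw [l2pair_eq_inner hf hf, l2norm_eq_norm_toLp hf, real_inner_self_eq_norm_sq]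

lemma l2norm_add_le {f g : ℝ → ℝ} (hf : MemLp f 2 lebΩ) (hg : MemLp g 2 lebΩ) :
    l2norm (fun x => f x + g x) ≤ l2norm f + l2norm g := by
  have := norm_add_le (hf.toLp f) (hg.toLp g)
  rwa [← MemLp.toLp_add, ← l2norm_eq_norm_toLp, ← l2norm_eq_norm_toLp, ← l2norm_eq_norm_toLp] at this

lemma l2norm_one : l2norm (fun _ => (1 : ℝ)) = 1 := by
  simp [l2norm, eLpNorm_const, NeZero.ne]

lemma l2norm_abs (f : ℝ → ℝ) : l2norm (fun x => |f x|) = l2norm f := by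
  rw [l2norm, l2norm]; congr 1; exact eLpNorm_norm f

lemma l2norm_sub_comm (f g : ℝ → ℝ) : l2norm (fun x => f x - g x) = l2norm (fun x => g x - f x) := by
  rw [← l2norm_abs, ← l2norm_abs (fun x => g x - f x)]; simp_rw [abs_sub_comm]

lemma integral_abs_le_l2norm {f : ℝ → ℝ} (hf : MemLp f 2 lebΩ) : ∫ x, |f x| ∂lebΩ ≤ l2norm f := by
  have := abs_l2pair_le (g := fun x => |f x|) (memLp_const (1 : ℝ)) hf.abs
  rw [l2norm_one, l2norm_abs, one_mul] at this
  simpa [l2pair] using (le_abs_self _).trans this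

lemma l2norm_le_of_bound {f : ℝ → ℝ} {B : ℝ} (hB0 : 0 ≤ B) (hB : ∀ᵐ x ∂lebΩ, |f x| ≤ B) :
    l2norm f ≤ B := by
  have := eLpNorm_le_of_ae_bound (p := 2) (f := f) hB
  refine ENNReal.toReal_le_of_le_ofReal hB0 (by simpa using this)

lemma abs_prim_le_l2norm {k : ℝ → ℝ} (hk : MemLp k 2 lebΩ) {x : ℝ} (hx : x ∈ Set.Icc (0 : ℝ) 1) :
    |prim k x| ≤ l2norm k :=
  (abs_prim_le hk.to_integrable hx).trans (integral_abs_le_l2norm hk)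

/-! ### Test functions -/

namespace IsTestFun

variable {φ ψ : ℝ → ℝ}

lemma continuous (h : IsTestFun φ) : Continuous φ := h.smooth.continuous

lemma differentiable (h : IsTestFun φ) : Differentiable ℝ φ := h.smooth.differentiable (by simp)

lemma smooth_deriv (h : IsTestFun φ) : ContDiff ℝ ∞ (deriv φ) :=
  (contDiff_infty_iff_deriv.1 h.smooth).2

lemma eq_zero (h : IsTestFun φ) {x : ℝ} (hx : x ∉ Ω) : φ x = 0 :=
  image_eq_zero_of_notMem_tsupport fun h' => hx (h.support h')

lemma deriv_isTestFun (h : IsTestFun φ) : IsTestFun (deriv φ) where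
  smooth := h.smooth_deriv
  compact := h.compact.deriv
  support := (closure_minimal (support_deriv_subset) (isClosed_tsupport φ)).trans h.support

lemma memLp_top (h : IsTestFun φ) : MemLp φ ⊤ lebΩ :=
  memLp_top_of_continuousOn h.continuous.continuousOn

lemma memLp_two (h : IsTestFun φ) : MemLp φ 2 lebΩ := h.memLp_top.top_to_two

lemma integrable (h : IsTestFun φ) : Integrable φ lebΩ := h.memLp_two.to_integrable

lemma const_mul (h : IsTestFun φ) (c : ℝ) : IsTestFun (fun x => c * φ x) where
  smooth := contDiff_const.mul h.smooth
  compact := h.compact.mul_left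
  support := (tsupport_mul_subset_right (f := fun _ => c)).trans h.support

lemma add (h : IsTestFun φ) (h' : IsTestFun ψ) : IsTestFun (fun x => φ x + ψ x) where
  smooth := h.smooth.add h'.smooth
  compact := h.compact.add h'.compact
  support := (tsupport_add φ ψ).trans (Set.union_subset h.support h'.support)

lemma sub (h : IsTestFun φ) (h' : IsTestFun ψ) : IsTestFun (fun x => φ x - ψ x) := by
  simpa [sub_eq_add_neg] using h.add (h'.const_mul (-1))

lemma eq_prim (h : IsTestFun φ) (x : ℝ) : φ x = prim (deriv φ) x := by
  rw [prim, intervalIntegral.integral_deriv_eq_sub (fun y _ => h.differentiable y)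
    (h.smooth_deriv.continuous.intervalIntegrable _ _), h.eq_zero (x := 0) (by simp [Ω]), sub_zero]

lemma integral_deriv (h : IsTestFun φ) : ∫ x, deriv φ x ∂lebΩ = 0 := by
  rw [← prim_one, ← h.eq_prim, h.eq_zero (by simp [Ω])]

lemma exists_Icc (h : IsTestFun φ) :
    ∃ a b, 0 < a ∧ a < 1 ∧ 0 < b ∧ b < 1 ∧ ∀ x, φ x ≠ 0 → x ∈ Set.Icc a b := by
  rcases (tsupport φ).eq_empty_or_nonempty with he | hne
  · refine ⟨1 / 2, 1 / 2, by norm_num, by norm_num, by norm_num, by norm_num, fun x hx => ?_⟩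
    have : x ∈ tsupport φ := subset_tsupport _ hx
    simp [he] at this
  · obtain ⟨a, ha, hal⟩ := h.compact.exists_isLeast hne
    obtain ⟨b, hb, hbl⟩ := h.compact.exists_isGreatest hne
    exact ⟨a, b, (h.support ha).1, (h.support ha).2, (h.support hb).1, (h.support hb).2,
      fun x hx => ⟨hal (subset_tsupport _ hx), hbl (subset_tsupport _ hx)⟩⟩

/-- The primitive is constant off the hull of the support: 0 on the left, and on the right the total
integral, which is 0 by hypothesis. -/
lemma isTestFun_prim (h : IsTestFun φ) (h0 : ∫ x, φ x ∂lebΩ = 0) : IsTestFun (prim φ) := by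
  have hd : ∀ x, HasDerivAt (prim φ) (φ x) x := fun x =>
    intervalIntegral.integral_hasDerivAt_right (h.continuous.intervalIntegrable _ _)
      (h.continuous.stronglyMeasurableAtFilter _ _) h.continuous.continuousAt
  have hderiv : deriv (prim φ) = φ := funext fun x => (hd x).deriv
  obtain ⟨a, b, ha, ha1, hb0, hb, hab⟩ := h.exists_Icc
  have hsub : tsupport (prim φ) ⊆ Set.Icc a b := by
    refine closure_minimal (fun x hx => ?_) isClosed_Icc
    by_contra hxab
    apply hx
    rw [Set.mem_Icc, not_and_or, not_le, not_le] at hxab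
    have hz : ∀ y, y ∉ Set.Icc a b → φ y = 0 := fun y hy => by
      by_contra h'; exact hy (hab y h')
    rcases hxab with hxa | hxb
    · refine (intervalIntegral.integral_congr (g := fun _ => 0) fun y hy => hz y ?_).trans (by simp)
      intro hy'
      have : y < a := lt_of_le_of_lt hy.2 (by simp [ha, hxa])
      exact absurd hy'.1 (not_le.2 this)
    · rw [prim, ← intervalIntegral.integral_add_adjacent_intervals
        (h.continuous.intervalIntegrable 0 1) (h.continuous.intervalIntegrable 1 x),
        intervalIntegral_eq, h0, zero_add]
      refine (intervalIntegral.integral_congr (g := fun _ => 0) fun y hy => hz y ?_).trans (by simp)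
      intro hy'
      have : b < y := lt_of_lt_of_le (by simp [hb, hxb]) hy.1
      exact absurd hy'.2 (not_le.2 this)
  refine ⟨contDiff_infty_iff_deriv.2 ⟨fun x => (hd x).differentiableAt, by rw [hderiv]; exact h.smooth⟩,
    HasCompactSupport.of_support_subset_isCompact isCompact_Icc ((subset_tsupport _).trans hsub),
    hsub.trans (Set.Icc_subset_Ioo ha hb)⟩

end IsTestFun

/-! ### Fundamental lemmas of the calculus of variations -/

lemma exists_bump {a b : ℝ} (ha : 0 ≤ a) (hab : a < b) (hb : b ≤ 1) :
    ∃ ψ, IsTestFun ψ ∧ (∀ x, x ∉ Set.Ioo a b → ψ x = 0) ∧ ∫ x, ψ x ∂lebΩ = 1 := by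
  let f : ContDiffBump ((a + b) / 2) := ⟨(b - a) / 8, (b - a) / 4, by linarith, by linarith⟩
  have hts : tsupport (f.normed volume) ⊆ Set.Ioo a b := by
    rw [f.tsupport_normed_eq, Real.closedBall_eq_Icc]
    exact Set.Icc_subset_Ioo (by simp only [f]; linarith) (by simp only [f]; linarith)
  have hz : ∀ x, x ∉ Set.Ioo a b → f.normed volume x = 0 := fun x hx =>
    image_eq_zero_of_notMem_tsupport fun h' => hx (hts h')
  refine ⟨f.normed volume, ⟨f.contDiff_normed, f.hasCompactSupport_normed,
    hts.trans (Set.Ioo_subset_Ioo ha hb)⟩, hz, ?_⟩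
  rw [← f.integral_normed (μ := volume), lebΩ]
  exact setIntegral_eq_integral_of_forall_compl_eq_zero fun x hx =>
    hz x fun h => hx (Set.Ioo_subset_Ioo ha hb h)

/-- Fundamental lemma of the calculus of variations on `Ω`. -/
lemma ae_eq_zero_of_l2pair {f : ℝ → ℝ} (hf : Integrable f lebΩ)
    (h : ∀ φ, IsTestFun φ → l2pair f φ = 0) : f =ᵐ[lebΩ] 0 := by
  have := isOpen_Ioo.ae_eq_zero_of_integral_contDiff_smul_eq_zero (μ := volume)
    (U := Set.Ioo (0 : ℝ) 1) (f := f) (IntegrableOn.locallyIntegrableOn hf) fun g h1 h2 h3 => by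
      have hg : IsTestFun g := ⟨h1, h2, h3⟩
      rw [← h g hg, l2pair, lebΩ, setIntegral_eq_integral_of_forall_compl_eq_zero]
      · simp [mul_comm]
      · intro x hx; rw [hg.eq_zero hx, mul_zero]
  rw [lebΩ, Ω, Filter.EventuallyEq, ae_restrict_iff' measurableSet_Ioo]
  exact this

lemma integrable_mul_test {f φ : ℝ → ℝ} (hf : Integrable f lebΩ) (hφ : MemLp φ ⊤ lebΩ) :
    Integrable (fun x => f x * φ x) lebΩ := by
  simpa [mul_comm] using integrable_mul_of_bdd hφ hf

/-- The lemma of du Bois-Reymond on `Ω`. -/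
lemma ae_eq_const_of_l2pair_deriv {f : ℝ → ℝ} (hf : Integrable f lebΩ)
    (h : ∀ φ, IsTestFun φ → l2pair f (deriv φ) = 0) : ∃ c, f =ᵐ[lebΩ] fun _ => c := by
  obtain ⟨ρ, hρ, -, hρ1⟩ := exists_bump (a := 0) (b := 1) le_rfl one_pos le_rfl
  refine ⟨l2pair f ρ, ?_⟩
  have key : (fun x => f x - l2pair f ρ) =ᵐ[lebΩ] 0 := by
    refine ae_eq_zero_of_l2pair (hf.sub (integrable_const _)) fun κ hκ => ?_
    -- Subtracting from `κ` its mass times `ρ` gives mean zero, so the result is the derivative of a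
    -- test function and is annihilated by `f`.
    have ht : IsTestFun (fun x => κ x - (∫ x, κ x ∂lebΩ) * ρ x) := hκ.sub (hρ.const_mul _)
    have hm : ∫ x, (κ x - (∫ x, κ x ∂lebΩ) * ρ x) ∂lebΩ = 0 := by
      rw [integral_sub hκ.integrable (hρ.integrable.const_mul _), integral_const_mul, hρ1]; ring
    have h1 := h _ (ht.isTestFun_prim hm)
    have hd : deriv (prim fun x => κ x - (∫ x, κ x ∂lebΩ) * ρ x)
        = fun x => κ x - (∫ x, κ x ∂lebΩ) * ρ x := by
      funext x
      exact (intervalIntegral.integral_hasDerivAt_right (ht.continuous.intervalIntegrable _ _)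
        (ht.continuous.stronglyMeasurableAtFilter _ _) ht.continuous.continuousAt).deriv
    rw [hd] at h1
    have e1 : l2pair f (fun x => κ x - (∫ x, κ x ∂lebΩ) * ρ x)
        = l2pair f κ - (∫ x, κ x ∂lebΩ) * l2pair f ρ := by
      simp only [l2pair]
      rw [← integral_const_mul, ← integral_sub (integrable_mul_test hf hκ.memLp_top)
        ((integrable_mul_test hf hρ.memLp_top).const_mul _)]
      congr 1; funext x; ring
    have e2 : l2pair (fun x => f x - l2pair f ρ) κ
        = l2pair f κ - (∫ x, κ x ∂lebΩ) * l2pair f ρ := by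
      rw [l2pair]
      simp only [sub_mul]
      rw [integral_sub (integrable_mul_test hf hκ.memLp_top) (hκ.integrable.const_mul _),
        integral_const_mul]
      simp only [l2pair]; ring
    rw [e2, ← e1, h1]
  filter_upwards [key] with x hx
  simpa [sub_eq_zero] using hx

/-! ### Density of derivatives of test functions -/

/-- The derivatives of test functions, as a subspace of `L²(Ω)`. -/
def testDerivs : Submodule ℝ (Lp ℝ 2 lebΩ) where
  carrier := {F | ∃ φ, IsTestFun φ ∧ F =ᵐ[lebΩ] deriv φ}
  add_mem' := by
    rintro F G ⟨φ, hφ, hF⟩ ⟨ψ, hψ, hG⟩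
    refine ⟨_, hφ.add hψ, ?_⟩
    filter_upwards [hF, hG, Lp.coeFn_add F G] with x h1 h2 h3
    rw [h3, deriv_fun_add (hφ.differentiable x) (hψ.differentiable x), Pi.add_apply, h1, h2]
  zero_mem' := ⟨fun x => 0, by
    obtain ⟨ρ, hρ, -, -⟩ := exists_bump (a := 0) (b := 1) le_rfl one_pos le_rfl
    simpa using hρ.const_mul 0, by
    rw [deriv_const']; exact Lp.coeFn_zero ℝ 2 lebΩ⟩
  smul_mem' := by
    rintro c F ⟨φ, hφ, hF⟩
    refine ⟨_, hφ.const_mul c, ?_⟩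
    filter_upwards [hF, Lp.coeFn_smul c F] with x h1 h3
    rw [h3, deriv_const_mul _ (hφ.differentiable x), Pi.smul_apply, h1, smul_eq_mul]

lemma toLp_deriv_mem_testDerivs {φ : ℝ → ℝ} (hφ : IsTestFun φ) :
    hφ.deriv_isTestFun.memLp_two.toLp (deriv φ) ∈ testDerivs :=
  ⟨φ, hφ, MemLp.coeFn_toLp _⟩

lemma l2pair_eq_inner' (F : Lp ℝ 2 lebΩ) {g : ℝ → ℝ} (hg : MemLp g 2 lebΩ) :
    l2pair F g = inner ℝ F (hg.toLp g) := by
  rw [l2pair_eq_inner (Lp.memLp F) hg, Lp.toLp_coeFn]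

/-- Zero mean `L²` functions are limits of derivatives of test functions. -/
lemma exists_test_deriv_near {k : ℝ → ℝ} (hk : MemLp k 2 lebΩ) (h0 : ∫ x, k x ∂lebΩ = 0) {ε : ℝ}
    (hε : 0 < ε) : ∃ φ, IsTestFun φ ∧ l2norm (fun x => k x - deriv φ x) < ε := by
  have hmem : hk.toLp k ∈ testDerivs.topologicalClosure := by
    -- By double orthogonality it suffices that `k` is orthogonal to everything orthogonal to the
    -- derivatives of test functions. By du Bois-Reymond those functions are constants.
    rw [← Submodule.orthogonal_orthogonal_eq_closure, Submodule.mem_orthogonal]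
    intro f hf
    obtain ⟨c, hc⟩ := ae_eq_const_of_l2pair_deriv (Lp.memLp f).to_integrable fun φ hφ => by
      rw [l2pair_eq_inner' f hφ.deriv_isTestFun.memLp_two]
      exact (Submodule.mem_orthogonal' _ _).1 hf _ (toLp_deriv_mem_testDerivs hφ)
    rw [← l2pair_eq_inner' f hk, l2pair_congr hc (ae_eq_refl k), l2pair, integral_const_mul, h0,
      mul_zero]
  obtain ⟨G, ⟨φ, hφ, hG⟩, hd⟩ := Metric.mem_closure_iff.1 hmem ε hε
  refine ⟨φ, hφ, ?_⟩
  rw [dist_eq_norm] at hd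
  change l2norm (k - deriv φ) < ε
  rw [l2norm_eq_norm_toLp (hk.sub hφ.deriv_isTestFun.memLp_two),
    MemLp.toLp_sub hk hφ.deriv_isTestFun.memLp_two]
  rwa [show hφ.deriv_isTestFun.memLp_two.toLp (deriv φ) = G from
    Lp.ext ((MemLp.coeFn_toLp _).trans hG.symm)]

/-! ### Functions of bounded variation -/

lemma l2pair_const_mul_right (c : ℝ) (f g : ℝ → ℝ) :
    l2pair f (fun x => c * g x) = c * l2pair f g := by
  rw [l2pair, l2pair, ← integral_const_mul]; congr 1; funext x; ring

lemma l2pair_const_mul_left (c : ℝ) (f g : ℝ → ℝ) :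
    l2pair (fun x => c * f x) g = c * l2pair f g := by
  rw [l2pair_comm, l2pair_const_mul_right, l2pair_comm]

/-- The total variation as a real number. -/
def tv (q : ℝ → ℝ) : ℝ := (totalVar q).toReal

lemma tv_nonneg (q : ℝ → ℝ) : 0 ≤ tv q := ENNReal.toReal_nonneg

lemma l2pair_deriv_le_tv {q : ℝ → ℝ} (hq : MemBV q) {φ : ℝ → ℝ} (hφ : IsTestFun φ)
    (h1 : ∀ x, |φ x| ≤ 1) : l2pair q (deriv φ) ≤ tv q := by
  rw [tv, ← ENNReal.ofReal_le_iff_le_toReal hq.totalVar_lt_top.ne]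
  exact le_iSup₂_of_le φ ⟨hφ, h1⟩ le_rfl

lemma l2pair_deriv_le {q : ℝ → ℝ} (hq : MemBV q) {φ : ℝ → ℝ} (hφ : IsTestFun φ) {c : ℝ}
    (hc : 0 < c) (h1 : ∀ x, |φ x| ≤ c) : l2pair q (deriv φ) ≤ c * tv q := by
  have h := l2pair_deriv_le_tv hq (hφ.const_mul c⁻¹) fun x => by
    rw [abs_mul, abs_of_pos (inv_pos.2 hc), inv_mul_le_iff₀ hc]; simpa using h1 x
  have hd : deriv (fun x => c⁻¹ * φ x) = fun x => c⁻¹ * deriv φ x :=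
    funext fun x => deriv_const_mul _ (hφ.differentiable x)
  rwa [hd, l2pair_const_mul_right, inv_mul_le_iff₀ hc] at h

lemma tv_le_of_forall {q : ℝ → ℝ} {c : ℝ} (hc : 0 ≤ c)
    (h : ∀ φ, IsTestFun φ → (∀ x, |φ x| ≤ 1) → l2pair q (deriv φ) ≤ c) :
    totalVar q ≤ ENNReal.ofReal c ∧ tv q ≤ c := by
  have : totalVar q ≤ ENNReal.ofReal c :=
    iSup₂_le fun φ hφ => ENNReal.ofReal_le_ofReal (h φ hφ.1 hφ.2)
  exact ⟨this, ENNReal.toReal_le_of_le_ofReal hc this⟩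

/-- The case `c = 0` is wanted because `c` will be an L² norm. Scaling needs a positive bound, so
`c` is first enlarged by `ε / (1 + tv q)`. -/
lemma MemBV.abs_l2pair_deriv_le {q : ℝ → ℝ} (hq : MemBV q) {φ : ℝ → ℝ} (hφ : IsTestFun φ) {c : ℝ}
    (hc : 0 ≤ c) (h1 : ∀ x, |φ x| ≤ c) : |l2pair q (deriv φ)| ≤ c * tv q := by
  have key : ∀ ψ, IsTestFun ψ → (∀ x, |ψ x| ≤ c) → l2pair q (deriv ψ) ≤ c * tv q := by
    intro ψ hψ hψc
    refine le_of_forall_pos_le_add fun ε hε => ?_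
    have := l2pair_deriv_le hq hψ (c := c + ε / (1 + tv q))
      (by have := tv_nonneg q; positivity) fun x => (hψc x).trans (by
        have := tv_nonneg q; simp only [le_add_iff_nonneg_right]; positivity)
    refine this.trans ?_
    rw [add_mul]
    have h3 : ε / (1 + tv q) * tv q ≤ ε := by
      have := tv_nonneg q
      rw [div_mul_eq_mul_div, div_le_iff₀ (by positivity)]
      nlinarith
    linarith
  rw [abs_le']
  refine ⟨key φ hφ h1, ?_⟩
  have := key _ (hφ.const_mul (-1)) fun x => by simpa using h1 x
  have hd : deriv (fun x => -1 * φ x) = fun x => -1 * deriv φ x :=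
    funext fun x => deriv_const_mul _ (hφ.differentiable x)
  rw [hd, l2pair_const_mul_right] at this
  linarith

lemma IsTestFun.abs_le_l2norm_deriv {φ : ℝ → ℝ} (hφ : IsTestFun φ) (x : ℝ) :
    |φ x| ≤ l2norm (deriv φ) := by
  by_cases hx : x ∈ Ω
  · rw [hφ.eq_prim x]
    exact abs_prim_le_l2norm hφ.deriv_isTestFun.memLp_two (Ω_subset_Icc hx)
  · rw [hφ.eq_zero hx, abs_zero]; exact l2norm_nonneg _

/-- `BV(Ω) ⊆ L²(Ω)`. -/
lemma MemBV.memLp_two {q : ℝ → ℝ} (hq : MemBV q) : MemLp q 2 lebΩ := by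
  have hint : ∀ F : testDerivs, Integrable (fun x => q x * (F : Lp ℝ 2 lebΩ) x) lebΩ := by
    rintro ⟨F, φ, hφ, hF⟩
    refine (integrable_mul_test hq.integrable hφ.deriv_isTestFun.memLp_top).congr ?_
    filter_upwards [hF] with x hx; simp [hx]
  let ℓ₀ : testDerivs →ₗ[ℝ] ℝ :=
    { toFun := fun F => l2pair q (F : Lp ℝ 2 lebΩ)
      map_add' := fun F G => by
        rw [l2pair, l2pair, l2pair, ← integral_add (hint F) (hint G)]
        refine integral_congr_ae ?_
        filter_upwards [Lp.coeFn_add (F : Lp ℝ 2 lebΩ) G] with x hx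
        simp only [Submodule.coe_add, hx, Pi.add_apply]; ring
      map_smul' := fun c F => by
        rw [RingHom.id_apply, smul_eq_mul, ← l2pair_const_mul_right]
        refine integral_congr_ae ?_
        filter_upwards [Lp.coeFn_smul c (F : Lp ℝ 2 lebΩ)] with x hx
        simp only [Submodule.coe_smul, hx, Pi.smul_apply, smul_eq_mul] }
  -- Since sup |φ| ≤ ‖φ'‖, finite variation makes φ' ↦ (q, φ') bounded for the L² norm. Hahn-Banach
  -- and Riesz then represent it by some `f` in L², and `q - f` annihilates all φ', so it is
  -- constant.
  let ℓ : testDerivs →L[ℝ] ℝ := ℓ₀.mkContinuous (tv q) (by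
    rintro ⟨F, φ, hφ, hF⟩
    change |l2pair q F| ≤ tv q * ‖F‖
    rw [l2pair_congr (ae_eq_refl q) hF, mul_comm]
    have hn : ‖F‖ = l2norm (deriv φ) := by rw [← l2norm_congr hF, l2norm, Lp.norm_def]
    rw [hn]
    exact hq.abs_l2pair_deriv_le hφ (l2norm_nonneg _) hφ.abs_le_l2norm_deriv)
  obtain ⟨g, hg, -⟩ := exists_extension_norm_eq testDerivs ℓ
  let f : Lp ℝ 2 lebΩ := (InnerProductSpace.toDual ℝ (Lp ℝ 2 lebΩ)).symm g
  obtain ⟨c, hc⟩ := ae_eq_const_of_l2pair_deriv (f := fun x => q x - f x)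
    (hq.integrable.sub (Lp.memLp f).to_integrable) fun φ hφ => by
      have hφ' := hφ.deriv_isTestFun
      have e1 : l2pair f (deriv φ) = l2pair q (deriv φ) := by
        rw [l2pair_eq_inner' f hφ'.memLp_two, InnerProductSpace.toDual_symm_apply,
          hg ⟨_, toLp_deriv_mem_testDerivs hφ⟩]
        exact l2pair_congr (ae_eq_refl q) (MemLp.coeFn_toLp hφ'.memLp_two)
      have e2 : l2pair (fun x => q x - f x) (deriv φ) = l2pair q (deriv φ) - l2pair f (deriv φ) := by
        rw [l2pair, l2pair, l2pair, ← integral_sub (integrable_mul_test hq.integrable hφ'.memLp_top)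
          (integrable_mul_test (Lp.memLp f).to_integrable hφ'.memLp_top)]
        simp only [sub_mul]
      rw [e2, e1, sub_self]
  refine ((Lp.memLp f).add (memLp_const c)).ae_eq ?_
  filter_upwards [hc] with x hx
  simp [← hx]

lemma integrable_mul_two {f g : ℝ → ℝ} (hf : MemLp f 2 lebΩ) (hg : MemLp g 2 lebΩ) :
    Integrable (fun x => f x * g x) lebΩ := hf.integrable_mul hg

lemma l2pair_sub_right {f g h : ℝ → ℝ} (hf : MemLp f 2 lebΩ) (hg : MemLp g 2 lebΩ)
    (hh : MemLp h 2 lebΩ) : l2pair f (fun x => g x - h x) = l2pair f g - l2pair f h := by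
  rw [l2pair, l2pair, l2pair, ← integral_sub (integrable_mul_two hf hg) (integrable_mul_two hf hh)]
  simp only [mul_sub]

lemma l2pair_add_right {f g h : ℝ → ℝ} (hf : MemLp f 2 lebΩ) (hg : MemLp g 2 lebΩ)
    (hh : MemLp h 2 lebΩ) : l2pair f (fun x => g x + h x) = l2pair f g + l2pair f h := by
  rw [l2pair, l2pair, l2pair, ← integral_add (integrable_mul_two hf hg) (integrable_mul_two hf hh)]
  simp only [mul_add]

lemma l2pair_add_left {f g h : ℝ → ℝ} (hf : MemLp f 2 lebΩ) (hg : MemLp g 2 lebΩ)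
    (hh : MemLp h 2 lebΩ) : l2pair (fun x => g x + h x) f = l2pair g f + l2pair h f := by
  rw [l2pair_comm, l2pair_add_right hf hg hh, l2pair_comm f, l2pair_comm f]

lemma l2pair_sub_left {f g h : ℝ → ℝ} (hf : MemLp f 2 lebΩ) (hg : MemLp g 2 lebΩ)
    (hh : MemLp h 2 lebΩ) : l2pair (fun x => g x - h x) f = l2pair g f - l2pair h f := by
  rw [l2pair_comm, l2pair_sub_right hf hg hh, l2pair_comm f, l2pair_comm f]

/-- Duality between the total variation and primitives vanishing at the end points. -/
lemma MemBV.l2pair_le_tv {q g : ℝ → ℝ} (hq : MemBV q) (hg : MemLp g 2 lebΩ)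
    (h0 : ∫ x, g x ∂lebΩ = 0) {c : ℝ} (hc : ∀ x ∈ Set.Icc (0 : ℝ) 1, |prim g x| ≤ c) :
    l2pair q g ≤ c * tv q := by
  have hc0 : 0 ≤ c := (abs_nonneg _).trans (hc 0 zero_mem_Icc)
  have hq2 := hq.memLp_two
  have ht := tv_nonneg q
  have hn := l2norm_nonneg q
  refine le_of_forall_pos_le_add fun ε hε => ?_
  -- `η` pays for two errors: φ exceeds the bound `c` by at most `η`, which costs `η * tv q`, and
  -- replacing `g` by φ' costs at most `η * l2norm q`.
  set η := ε / (1 + tv q + l2norm q) with hη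
  have hη0 : 0 < η := by positivity
  obtain ⟨φ, hφ, hφε⟩ := exists_test_deriv_near hg h0 hη0
  have hφ' := hφ.deriv_isTestFun.memLp_two
  have hφc : ∀ x, |φ x| ≤ c + η := by
    intro x
    by_cases hx : x ∈ Ω
    · have hx' := Ω_subset_Icc hx
      have h1 := abs_prim_le_l2norm (hg.sub hφ') hx'
      have h2 : prim (g - deriv φ) x = prim g x - prim (deriv φ) x :=
        prim_sub hg.to_integrable hφ'.to_integrable hx'
      rw [h2, ← hφ.eq_prim] at h1
      have h3 := hc x hx'
      have h4 : l2norm (g - deriv φ) < η := hφε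
      rw [abs_le] at *
      constructor <;> linarith
    · rw [hφ.eq_zero hx, abs_zero]; positivity
  have h1 := (le_abs_self _).trans (hq.abs_l2pair_deriv_le hφ (by positivity) hφc)
  have h2 := (le_abs_self _).trans (abs_l2pair_le hq2 (hg.sub hφ'))
  have h3 : l2pair q (g - deriv φ) = l2pair q g - l2pair q (deriv φ) := l2pair_sub_right hq2 hg hφ'
  have h4 : l2norm q * l2norm (g - deriv φ) ≤ l2norm q * η := by
    gcongr; exact hφε.le
  have h5 : η * (1 + tv q + l2norm q) = ε := by rw [hη]; field_simp
  nlinarith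

/-! ### Characterization of `H¹₀(Ω)` -/

lemma ae_eq_of_l2norm_sub {f g : ℝ → ℝ} (hf : MemLp f 2 lebΩ) (hg : MemLp g 2 lebΩ)
    (h : ∀ ε, 0 < ε → l2norm (fun x => f x - g x) ≤ ε) : f =ᵐ[lebΩ] g := by
  have h0 : l2norm (f - g) = 0 :=
    le_antisymm (le_of_forall_pos_le_add fun ε hε => (h ε hε).trans_eq (zero_add ε).symm) (l2norm_nonneg _)
  rw [l2norm_eq_norm_toLp (hf.sub hg), norm_eq_zero, MemLp.toLp_sub hf hg, sub_eq_zero,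
    MemLp.toLp_eq_toLp_iff] at h0
  exact h0

lemma IsH10.integral_deriv {v dv : ℝ → ℝ} (h : IsH10 v dv) : ∫ x, dv x ∂lebΩ = 0 := by
  rw [← abs_eq_zero]
  refine le_antisymm (le_of_forall_pos_le_add fun ε hε => ?_) (abs_nonneg _)
  obtain ⟨φ, hφ, -, h2⟩ := h.approx ε hε
  have hφ' := hφ.deriv_isTestFun.memLp_two
  have h3 : ∫ x, (dv x - deriv φ x) ∂lebΩ = ∫ x, dv x ∂lebΩ := by
    rw [integral_sub h.memLp_deriv.to_integrable hφ'.to_integrable, hφ.integral_deriv, sub_zero]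
  rw [← h3, zero_add]
  exact (abs_integral_le_integral_abs).trans
    ((integral_abs_le_l2norm (h.memLp_deriv.sub hφ')).trans h2.le)

lemma IsH10.integrable_deriv {v dv : ℝ → ℝ} (h : IsH10 v dv) : Integrable dv lebΩ :=
  h.memLp_deriv.to_integrable

/-- Test functions equal the primitive of their derivative, and `prim` is bounded from L² to the
supremum norm, so the identity survives the limit in `approx`. -/
lemma IsH10.ae_eq_prim {v dv : ℝ → ℝ} (h : IsH10 v dv) : v =ᵐ[lebΩ] prim dv := by
  refine ae_eq_of_l2norm_sub h.memLp (memLp_top_prim h.integrable_deriv).top_to_two fun ε hε => ?_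
  obtain ⟨φ, hφ, h1, h2⟩ := h.approx (ε / 2) (half_pos hε)
  have hφ' := hφ.deriv_isTestFun.memLp_two
  have hp2 := (memLp_top_prim h.integrable_deriv).top_to_two
  have h3 : l2norm (fun x => φ x - prim dv x) ≤ ε / 2 := by
    refine (l2norm_le_of_bound (half_pos hε).le ?_)
    filter_upwards [ae_mem_Icc] with x hx
    have h4 : |prim (dv - deriv φ) x| ≤ _ := abs_prim_le_l2norm (h.memLp_deriv.sub hφ') hx
    have h5 : prim (dv - deriv φ) x = prim dv x - prim (deriv φ) x :=
      prim_sub h.integrable_deriv hφ'.to_integrable hx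
    rw [h5, ← hφ.eq_prim, abs_sub_comm] at h4
    exact h4.trans h2.le
  have h6 := l2norm_add_le (h.memLp.sub hφ.memLp_two) (hφ.memLp_two.sub hp2)
  simp only [Pi.sub_apply, sub_add_sub_cancel] at h6
  have h7 : l2norm (v - φ) < ε / 2 := h1
  have h8 : l2norm (φ - prim dv) ≤ ε / 2 := h3
  linarith

/-- Converse of `IsH10.ae_eq_prim`: up to null sets, H¹₀ is parametrized by the zero mean functions
in L², and existence of solutions is proved on that side. -/
lemma isH10_prim {k : ℝ → ℝ} (hk : MemLp k 2 lebΩ) (h0 : ∫ x, k x ∂lebΩ = 0) :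
    IsH10 (prim k) k where
  memLp := (memLp_top_prim hk.to_integrable).top_to_two
  memLp_deriv := hk
  weakDeriv φ hφ := by
    have h := integral_prim_mul hk.to_integrable hφ.deriv_isTestFun.integrable
    rw [prim_one, h0, zero_mul, zero_sub] at h
    rw [l2pair, h, l2pair]
    simp only [← hφ.eq_prim]
  approx ε hε := by
    obtain ⟨φ, hφ, h⟩ := exists_test_deriv_near hk h0 (half_pos hε)
    have hφ' := hφ.deriv_isTestFun.memLp_two
    refine ⟨φ, hφ, ?_, h.trans (half_lt_self hε)⟩
    refine lt_of_le_of_lt (l2norm_le_of_bound (half_pos hε).le ?_) (half_lt_self hε)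
    filter_upwards [ae_mem_Icc] with x hx
    have h4 : |prim (k - deriv φ) x| ≤ _ := abs_prim_le_l2norm (hk.sub hφ') hx
    have h5 : prim (k - deriv φ) x = prim k x - prim (deriv φ) x :=
      prim_sub hk.to_integrable hφ'.to_integrable hx
    rw [h5, ← hφ.eq_prim] at h4
    exact h4.trans h.le

/-! ### The bilinear form -/

/-- The standing assumptions on the coefficients. -/
structure IsElliptic (a d₀ : ℝ → ℝ) (K : ℝ≥0) (ν : ℝ) : Prop where
  lip : LipschitzOnWith K a (Set.Icc 0 1)
  pos : 0 < ν
  ge : ∀ x ∈ Set.Icc (0 : ℝ) 1, ν ≤ a x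
  memLp : MemLp d₀ ⊤ lebΩ
  nonneg : ∀ᵐ x ∂lebΩ, 0 ≤ d₀ x

section bform

variable {a d₀ : ℝ → ℝ} {K : ℝ≥0} {ν : ℝ}

lemma IsElliptic.memLp_a (h : IsElliptic a d₀ K ν) : MemLp a ⊤ lebΩ :=
  memLp_top_of_continuousOn h.lip.continuousOn

lemma bform_comm (v dv w dw : ℝ → ℝ) : bform a d₀ v dv w dw = bform a d₀ w dw v dv := by
  simp only [bform, l2pair]
  congr 2 <;> funext x <;> ring

lemma bform_congr {v v' dv dv' w w' dw dw' : ℝ → ℝ} (h1 : v =ᵐ[lebΩ] v') (h2 : dv =ᵐ[lebΩ] dv')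
    (h3 : w =ᵐ[lebΩ] w') (h4 : dw =ᵐ[lebΩ] dw') :
    bform a d₀ v dv w dw = bform a d₀ v' dv' w' dw' := by
  rw [bform, bform, l2pair_congr (f' := fun x => a x * dv' x) (h2.mono fun x hx => by simp [hx]) h4,
    l2pair_congr (f' := fun x => d₀ x * v' x) (h1.mono fun x hx => by simp [hx]) h3]

lemma bform_add_right (h : IsElliptic a d₀ K ν) {v dv w dw w' dw' : ℝ → ℝ}
    (hv : MemLp v 2 lebΩ) (hdv : MemLp dv 2 lebΩ) (hw : MemLp w 2 lebΩ) (hdw : MemLp dw 2 lebΩ)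
    (hw' : MemLp w' 2 lebΩ) (hdw' : MemLp dw' 2 lebΩ) :
    bform a d₀ v dv (fun x => w x + w' x) (fun x => dw x + dw' x)
      = bform a d₀ v dv w dw + bform a d₀ v dv w' dw' := by
  rw [bform, l2pair_add_right (memLp_two_mul_of_bdd h.memLp_a hdv) hdw hdw',
    l2pair_add_right (memLp_two_mul_of_bdd h.memLp hv) hw hw', bform, bform]
  ring

lemma bform_smul_right (c : ℝ) (v dv w dw : ℝ → ℝ) :
    bform a d₀ v dv (fun x => c * w x) (fun x => c * dw x) = c * bform a d₀ v dv w dw := by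
  rw [bform, l2pair_const_mul_right, l2pair_const_mul_right, bform]; ring

lemma bform_sub_right (h : IsElliptic a d₀ K ν) {v dv w dw w' dw' : ℝ → ℝ}
    (hv : MemLp v 2 lebΩ) (hdv : MemLp dv 2 lebΩ) (hw : MemLp w 2 lebΩ) (hdw : MemLp dw 2 lebΩ)
    (hw' : MemLp w' 2 lebΩ) (hdw' : MemLp dw' 2 lebΩ) :
    bform a d₀ v dv (fun x => w x - w' x) (fun x => dw x - dw' x)
      = bform a d₀ v dv w dw - bform a d₀ v dv w' dw' := by
  rw [bform, l2pair_sub_right (memLp_two_mul_of_bdd h.memLp_a hdv) hdw hdw',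
    l2pair_sub_right (memLp_two_mul_of_bdd h.memLp hv) hw hw', bform, bform]
  ring

lemma bform_add_left (h : IsElliptic a d₀ K ν) {v dv w dw w' dw' : ℝ → ℝ}
    (hv : MemLp v 2 lebΩ) (hdv : MemLp dv 2 lebΩ) (hw : MemLp w 2 lebΩ) (hdw : MemLp dw 2 lebΩ)
    (hw' : MemLp w' 2 lebΩ) (hdw' : MemLp dw' 2 lebΩ) :
    bform a d₀ (fun x => w x + w' x) (fun x => dw x + dw' x) v dv
      = bform a d₀ w dw v dv + bform a d₀ w' dw' v dv := by
  rw [bform_comm, bform_add_right h hv hdv hw hdw hw' hdw', bform_comm v, bform_comm v]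

lemma bform_sub_left (h : IsElliptic a d₀ K ν) {v dv w dw w' dw' : ℝ → ℝ}
    (hv : MemLp v 2 lebΩ) (hdv : MemLp dv 2 lebΩ) (hw : MemLp w 2 lebΩ) (hdw : MemLp dw 2 lebΩ)
    (hw' : MemLp w' 2 lebΩ) (hdw' : MemLp dw' 2 lebΩ) :
    bform a d₀ (fun x => w x - w' x) (fun x => dw x - dw' x) v dv
      = bform a d₀ w dw v dv - bform a d₀ w' dw' v dv := by
  rw [bform_comm, bform_sub_right h hv hdv hw hdw hw' hdw', bform_comm v, bform_comm v]

lemma bform_smul_left (c : ℝ) (v dv w dw : ℝ → ℝ) :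
    bform a d₀ (fun x => c * w x) (fun x => c * dw x) v dv = c * bform a d₀ w dw v dv := by
  rw [bform_comm, bform_smul_right, bform_comm]

lemma IsElliptic.coercive (h : IsElliptic a d₀ K ν) (v : ℝ → ℝ) {dv : ℝ → ℝ}
    (hdv : MemLp dv 2 lebΩ) : ν * l2norm dv ^ 2 ≤ bform a d₀ v dv v dv := by
  have h1 : ν * l2norm dv ^ 2 ≤ l2pair (fun x => a x * dv x) dv := by
    rw [l2norm_sq hdv, l2pair, l2pair, ← integral_const_mul]
    refine integral_mono_ae ((integrable_mul_two hdv hdv).const_mul _)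
      (integrable_mul_two (memLp_two_mul_of_bdd h.memLp_a hdv) hdv) ?_
    filter_upwards [ae_mem_Icc] with x hx
    have := h.ge x hx
    nlinarith [mul_self_nonneg (dv x)]
  have h2 : 0 ≤ l2pair (fun x => d₀ x * v x) v := by
    refine integral_nonneg_of_ae ?_
    filter_upwards [h.nonneg] with x hx
    have := mul_nonneg hx (mul_self_nonneg (v x))
    simpa [mul_assoc] using this
  rw [bform]; linarith

lemma l2norm_mul_le {b f : ℝ → ℝ} {B : ℝ} (hB0 : 0 ≤ B) (hb : ∀ᵐ x ∂lebΩ, |b x| ≤ B)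
    (hf : MemLp f 2 lebΩ) : l2norm (fun x => b x * f x) ≤ B * l2norm f := by
  have h := eLpNorm_le_mul_eLpNorm_of_ae_le_mul (f := fun x => b x * f x) (g := f) (μ := lebΩ)
    (c := B) (hb.mono fun x hx => by
      rw [norm_mul]; exact mul_le_mul_of_nonneg_right hx (norm_nonneg _)) 2
  have h2 := ENNReal.toReal_mono (ENNReal.mul_ne_top ENNReal.ofReal_ne_top hf.2.ne) h
  rwa [ENNReal.toReal_mul, ENNReal.toReal_ofReal hB0] at h2

lemma l2norm_prim_le {k : ℝ → ℝ} (hk : MemLp k 2 lebΩ) : l2norm (prim k) ≤ l2norm k :=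
  l2norm_le_of_bound (l2norm_nonneg _) (ae_mem_Icc.mono fun _ hx => abs_prim_le_l2norm hk hx)

lemma memLp_two_prim {k : ℝ → ℝ} (hk : MemLp k 2 lebΩ) : MemLp (prim k) 2 lebΩ :=
  (memLp_top_prim hk.to_integrable).top_to_two

lemma IsElliptic.exists_bform_le (h : IsElliptic a d₀ K ν) : ∃ B, 0 ≤ B ∧ ∀ k l : ℝ → ℝ,
    MemLp k 2 lebΩ → MemLp l 2 lebΩ →
      |bform a d₀ (prim k) k (prim l) l| ≤ B * l2norm k * l2norm l := by
  obtain ⟨A, hA0, hA⟩ := exists_bound_of_memLp_top h.memLp_a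
  obtain ⟨D, hD0, hD⟩ := exists_bound_of_memLp_top h.memLp
  refine ⟨A + D, by positivity, fun k l hk hl => ?_⟩
  have hk' := memLp_two_prim hk
  have hl' := memLp_two_prim hl
  have h1 := abs_l2pair_le (memLp_two_mul_of_bdd h.memLp_a hk) hl
  have h2 := abs_l2pair_le (memLp_two_mul_of_bdd h.memLp hk') hl'
  have h3 := l2norm_mul_le hA0 hA hk
  have h4 := (l2norm_mul_le hD0 hD hk').trans
    (mul_le_mul_of_nonneg_left (l2norm_prim_le hk) hD0)
  have h5 := l2norm_prim_le hl
  have h6 := l2norm_nonneg l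
  have h7 := l2norm_nonneg k
  rw [bform]
  refine (abs_add_le _ _).trans ?_
  have e1 := h1.trans (mul_le_mul_of_nonneg_right h3 h6)
  have e2 := h2.trans (mul_le_mul h4 h5 (l2norm_nonneg _) (by positivity))
  nlinarith

lemma prim_coeFn_add (F G : Lp ℝ 2 lebΩ) :
    prim (F + G : Lp ℝ 2 lebΩ) =ᵐ[lebΩ] fun x => prim F x + prim G x := by
  filter_upwards [ae_mem_Icc] with x hx
  rw [prim_congr (Lp.coeFn_add F G) hx]
  exact prim_add (Lp.memLp F).to_integrable (Lp.memLp G).to_integrable hx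

lemma prim_coeFn_smul (c : ℝ) (F : Lp ℝ 2 lebΩ) :
    prim (c • F : Lp ℝ 2 lebΩ) =ᵐ[lebΩ] fun x => c * prim F x := by
  filter_upwards [ae_mem_Icc] with x hx
  rw [prim_congr (Lp.coeFn_smul c F) hx]
  exact prim_const_mul c F x

lemma coeFn_add' (F G : Lp ℝ 2 lebΩ) :
    ((F + G : Lp ℝ 2 lebΩ) : ℝ → ℝ) =ᵐ[lebΩ] fun x => F x + G x := Lp.coeFn_add F G

lemma coeFn_smul' (c : ℝ) (F : Lp ℝ 2 lebΩ) :
    ((c • F : Lp ℝ 2 lebΩ) : ℝ → ℝ) =ᵐ[lebΩ] fun x => c * F x := Lp.coeFn_smul c F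

lemma l2norm_coeFn (F : Lp ℝ 2 lebΩ) : l2norm F = ‖F‖ := (Lp.norm_def F).symm

/-- The bilinear form in terms of the weak derivatives, as a bounded bilinear form on `L²(Ω)`. -/
lemma IsElliptic.exists_clm (h : IsElliptic a d₀ K ν) :
    ∃ B : Lp ℝ 2 lebΩ →L[ℝ] Lp ℝ 2 lebΩ →L[ℝ] ℝ,
      ∀ k l : Lp ℝ 2 lebΩ, B k l = bform a d₀ (prim k) k (prim l) l := by
  obtain ⟨C, -, hC⟩ := h.exists_bform_le
  have m1 : ∀ k : Lp ℝ 2 lebΩ, MemLp k 2 lebΩ := Lp.memLp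
  have m2 : ∀ k : Lp ℝ 2 lebΩ, MemLp (prim k) 2 lebΩ := fun k => memLp_two_prim (m1 k)
  refine ⟨LinearMap.mkContinuous₂ (LinearMap.mk₂ ℝ
    (fun k l : Lp ℝ 2 lebΩ => bform a d₀ (prim k) k (prim l) l) ?_ ?_ ?_ ?_) C ?_, fun k l => rfl⟩
  · intro k k' l
    rw [bform_congr (prim_coeFn_add k k') (coeFn_add' k k') (ae_eq_refl _) (ae_eq_refl _)]
    exact bform_add_left h (m2 _) (m1 _) (m2 _) (m1 _) (m2 _) (m1 _)
  · intro c k l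
    rw [bform_congr (prim_coeFn_smul c k) (coeFn_smul' c k) (ae_eq_refl _) (ae_eq_refl _)]
    exact bform_smul_left _ _ _ _ _
  · intro k l l'
    rw [bform_congr (ae_eq_refl _) (ae_eq_refl _) (prim_coeFn_add l l') (coeFn_add' l l')]
    exact bform_add_right h (m2 _) (m1 _) (m2 _) (m1 _) (m2 _) (m1 _)
  · intro c k l
    rw [bform_congr (ae_eq_refl _) (ae_eq_refl _) (prim_coeFn_smul c l) (coeFn_smul' c l)]
    exact bform_smul_right _ _ _ _ _
  · intro k l
    rw [← l2norm_coeFn, ← l2norm_coeFn]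
    exact hC k l (m1 k) (m1 l)

/-- Lax-Milgram on complete subspaces of `L²(Ω)` (spaces of weak derivatives). -/
lemma IsElliptic.exists_solution (h : IsElliptic a d₀ K ν) (E : Submodule ℝ (Lp ℝ 2 lebΩ))
    [CompleteSpace E] (F : Lp ℝ 2 lebΩ →L[ℝ] ℝ) :
    ∃ k ∈ E, ∀ l ∈ E, bform a d₀ (prim k) k (prim l) l = F l := by
  obtain ⟨B, hB⟩ := h.exists_clm
  -- The L² norm of the weak derivative serves as the energy norm, so coercivity on any subspace is
  -- inherited from the whole space.
  have hco : IsCoercive (B.bilinearComp E.subtypeL E.subtypeL) := by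
    refine ⟨ν, h.pos, fun k => ?_⟩
    have := h.coercive (prim (k : Lp ℝ 2 lebΩ)) (Lp.memLp (k : Lp ℝ 2 lebΩ))
    rw [← hB, l2norm_coeFn] at this
    calc ν * ‖k‖ * ‖k‖ = ν * ‖(k : Lp ℝ 2 lebΩ)‖ ^ 2 := by rw [Submodule.coe_norm]; ring
      _ ≤ _ := this
  let f : E := (InnerProductSpace.toDual ℝ E).symm (F.comp E.subtypeL)
  refine ⟨(hco.continuousLinearEquivOfBilin.symm f : E), Subtype.coe_prop _, fun l hl => ?_⟩
  have h1 := hco.continuousLinearEquivOfBilin_apply (hco.continuousLinearEquivOfBilin.symm f) ⟨l, hl⟩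
  rw [ContinuousLinearEquiv.apply_symm_apply, InnerProductSpace.toDual_symm_apply] at h1
  rw [← hB]
  exact h1.symm

/-- The functional `l ↦ (p, ∫₀ l)` for integrable `p`. -/
lemma exists_clm_l2pair_prim {p : ℝ → ℝ} (hp : Integrable p lebΩ) :
    ∃ F : Lp ℝ 2 lebΩ →L[ℝ] ℝ, ∀ l : Lp ℝ 2 lebΩ, F l = l2pair p (prim l) := by
  have m1 : ∀ k : Lp ℝ 2 lebΩ, Integrable (fun x => p x * prim k x) lebΩ := fun k =>
    integrable_mul_test hp (memLp_top_prim (Lp.memLp k).to_integrable)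
  refine ⟨LinearMap.mkContinuous ⟨⟨fun l : Lp ℝ 2 lebΩ => l2pair p (prim l), ?_⟩, ?_⟩
    (∫ x, |p x| ∂lebΩ) ?_, fun l => rfl⟩
  · intro k l
    rw [l2pair_congr (ae_eq_refl p) (prim_coeFn_add k l)]
    simp only [l2pair, mul_add]
    exact integral_add (m1 k) (m1 l)
  · intro c k
    change l2pair _ _ = c * l2pair _ _
    rw [l2pair_congr (ae_eq_refl p) (prim_coeFn_smul c k), l2pair_const_mul_right]
  · intro l
    change |l2pair p (prim l)| ≤ _
    rw [l2pair, ← integral_mul_const]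
    refine norm_integral_le_of_norm_le (f := fun x => p x * prim l x) (hp.abs.mul_const _) ?_
    filter_upwards [ae_mem_Icc] with x hx
    rw [norm_mul, ← l2norm_coeFn]
    exact mul_le_mul_of_nonneg_left (abs_prim_le_l2norm (Lp.memLp l) hx) (norm_nonneg _)

/-- The zero mean functions in `L²(Ω)`. -/
def zeroMean : Submodule ℝ (Lp ℝ 2 lebΩ) := (ℝ ∙ (memLp_const (1 : ℝ)).toLp (fun _ : ℝ => (1 : ℝ)))ᗮ

lemma mem_zeroMean {F : Lp ℝ 2 lebΩ} : F ∈ zeroMean ↔ ∫ x, F x ∂lebΩ = 0 := by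
  rw [zeroMean, Submodule.mem_orthogonal_singleton_iff_inner_left,
    ← l2pair_eq_inner' F (memLp_const (1 : ℝ))]
  simp [l2pair]

instance : CompleteSpace zeroMean := by
  rw [zeroMean]; infer_instance

lemma integral_toLp {k : ℝ → ℝ} (hk : MemLp k 2 lebΩ) :
    ∫ x, hk.toLp k x ∂lebΩ = ∫ x, k x ∂lebΩ := integral_congr_ae hk.coeFn_toLp

lemma prim_toLp {k : ℝ → ℝ} (hk : MemLp k 2 lebΩ) : prim (hk.toLp k) =ᵐ[lebΩ] prim k :=
  ae_mem_Icc.mono fun _ hx => prim_congr hk.coeFn_toLp hx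

/-- Translates a test pair `v`, `dv` into an element of L², the form in which `exists_solution`
delivers its equation. -/
lemma bform_eq_toLp {v dv : ℝ → ℝ} (k : ℝ → ℝ) (h : IsH10 v dv) :
    bform a d₀ (prim k) k v dv
      = bform a d₀ (prim k) k (prim (h.memLp_deriv.toLp dv)) (h.memLp_deriv.toLp dv) :=
  bform_congr (ae_eq_refl _) (ae_eq_refl _)
    (h.ae_eq_prim.trans (prim_toLp _).symm) h.memLp_deriv.coeFn_toLp.symm

lemma l2pair_eq_toLp {v dv : ℝ → ℝ} (p : ℝ → ℝ) (h : IsH10 v dv) :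
    l2pair p v = l2pair p (prim (h.memLp_deriv.toLp dv)) :=
  l2pair_congr (ae_eq_refl _) (h.ae_eq_prim.trans (prim_toLp _).symm)

/-- Every integrable right hand side has a state. -/
lemma IsElliptic.exists_state (h : IsElliptic a d₀ K ν) {p : ℝ → ℝ} (hp : Integrable p lebΩ) :
    ∃ u, IsState a d₀ p u := by
  obtain ⟨F, hF⟩ := exists_clm_l2pair_prim hp
  obtain ⟨k, hk, hkl⟩ := h.exists_solution zeroMean F
  refine ⟨prim k, k, isH10_prim (Lp.memLp k) (mem_zeroMean.1 hk), fun w dw hw => ?_⟩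
  rw [bform_eq_toLp _ hw, hkl _ (mem_zeroMean.2 (by rw [integral_toLp, hw.integral_deriv])), hF,
    l2pair_eq_toLp _ hw]

end bform

/-! ### Meshes and step functions -/

namespace Mesh

variable (M : Mesh)

lemma node_mem_Icc (j : Fin (M.l + 1)) : M.node j ∈ Set.Icc (0 : ℝ) 1 :=
  ⟨M.node_zero ▸ M.strictMono.monotone (Fin.zero_le j),
    M.node_last ▸ M.strictMono.monotone (Fin.le_last j)⟩

/-- The length of a cell. -/
def len (i : Fin M.l) : ℝ := M.node i.succ - M.node i.castSucc

lemma node_lt (i : Fin M.l) : M.node i.castSucc < M.node i.succ :=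
  M.strictMono i.castSucc_lt_succ

lemma len_pos (i : Fin M.l) : 0 < M.len i := sub_pos.2 (M.node_lt i)

lemma len_le_width (i : Fin M.l) : M.len i ≤ M.width :=
  le_ciSup (f := fun i : Fin M.l => M.node i.succ - M.node i.castSucc) (Set.finite_range _).bddAbove i

lemma width_pos : 0 < M.width :=
  (M.len_pos ⟨0, by have := M.one_lt; omega⟩).trans_le (M.len_le_width _)

lemma width_le_one : M.width ≤ 1 := by
  have : Nonempty (Fin M.l) := ⟨⟨0, by have := M.one_lt; omega⟩⟩
  refine ciSup_le fun i => ?_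
  have h1 := (M.node_mem_Icc i.succ).2
  have h2 := (M.node_mem_Icc i.castSucc).1
  linarith

lemma cell_subset_Ω (i : Fin M.l) : M.cell i ⊆ Ω :=
  Set.Ioo_subset_Ioo (M.node_mem_Icc _).1 (M.node_mem_Icc _).2

lemma cell_disjoint {i j : Fin M.l} {x : ℝ} (hi : x ∈ M.cell i) (hj : x ∈ M.cell j) : i = j := by
  by_contra hne
  rcases lt_or_gt_of_ne hne with h | h
  · have : M.node i.succ ≤ M.node j.castSucc :=
      M.strictMono.monotone (by rw [Fin.le_def]; simpa using h)
    exact absurd (hi.2.trans_le this) (not_lt.2 hj.1.le)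
  · have : M.node j.succ ≤ M.node i.castSucc :=
      M.strictMono.monotone (by rw [Fin.le_def]; simpa using h)
    exact absurd (hj.2.trans_le this) (not_lt.2 hi.1.le)

lemma exists_mem_cell {x : ℝ} (hx : x ∈ Ω) (hn : x ∉ Set.range M.node) : ∃ i, x ∈ M.cell i := by
  by_contra! hc
  have : ∀ j, M.node j < x := by
    intro j
    induction j using Fin.induction with
    | zero => rw [M.node_zero]; exact hx.1
    | succ i ih =>
      have := hc i
      rw [cell, Set.mem_Ioo, not_and, not_lt] at this
      exact lt_of_le_of_ne (this ih) fun h => hn ⟨_, h⟩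
  have h1 := this (Fin.last _)
  rw [M.node_last] at h1
  exact absurd hx.2 (not_lt.2 h1.le)

lemma ae_mem_cell : ∀ᵐ x ∂lebΩ, ∃ i, x ∈ M.cell i := by
  filter_upwards [ae_mem_Ω, ae_restrict_of_ae ((Set.finite_range M.node).countable.ae_notMem volume)] with x h1 h2
  exact M.exists_mem_cell h1 h2

lemma lebΩ_eq_iUnion : lebΩ = volume.restrict (⋃ i, M.cell i) := by
  refine Measure.restrict_congr_set ?_
  have h := M.ae_mem_cell
  rw [lebΩ, Ω, ae_restrict_iff' measurableSet_Ioo] at h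
  refine Filter.eventuallyLE_antisymm_iff.2 ⟨?_, ?_⟩
  · filter_upwards [h] with x hx hx'
    exact Set.mem_iUnion.2 (hx hx')
  · exact Filter.Eventually.of_forall fun x hx => by
      obtain ⟨i, hi⟩ := Set.mem_iUnion.1 hx
      exact M.cell_subset_Ω i hi

lemma integrableOn_cell {f : ℝ → ℝ} (hf : Integrable f lebΩ) (i : Fin M.l) :
    IntegrableOn f (M.cell i) := IntegrableOn.mono_set (t := Ω) hf (M.cell_subset_Ω i)

lemma integral_eq_sum {f : ℝ → ℝ} (hf : Integrable f lebΩ) :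
    ∫ x, f x ∂lebΩ = ∑ i, ∫ x in M.cell i, f x := by
  rw [M.lebΩ_eq_iUnion]
  exact integral_iUnion_fintype (fun i => measurableSet_Ioo)
    (fun i j hij => Set.disjoint_left.2 fun x hi hj => hij (M.cell_disjoint hi hj))
    fun i => M.integrableOn_cell hf i

/-- The step function with value `c i` on the `i`-th cell. -/
def step (c : Fin M.l → ℝ) (x : ℝ) : ℝ := ∑ i, (M.cell i).indicator (fun _ => c i) x

variable {M}

lemma step_apply (c : Fin M.l → ℝ) {i : Fin M.l} {x : ℝ} (hx : x ∈ M.cell i) :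
    M.step c x = c i := by
  rw [step, Finset.sum_eq_single i]
  · exact Set.indicator_of_mem hx _
  · intro j _ hj
    exact Set.indicator_of_notMem (fun h => hj (M.cell_disjoint h hx)) _
  · simp

lemma memLp_step (c : Fin M.l → ℝ) : MemLp (M.step c) ⊤ lebΩ := by
  have hm : Measurable (M.step c) := Finset.measurable_fun_sum _ fun i _ =>
    measurable_const.indicator measurableSet_Ioo
  refine memLp_top_of_bound hm.aestronglyMeasurable (∑ i, |c i|) ?_
  filter_upwards [M.ae_mem_cell] with x ⟨i, hi⟩
  rw [step_apply c hi]
  exact Finset.single_le_sum (f := fun i => |c i|) (fun j _ => abs_nonneg _) (Finset.mem_univ i)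

lemma l2pair_step {f : ℝ → ℝ} (hf : Integrable f lebΩ) (c : Fin M.l → ℝ) :
    l2pair f (M.step c) = ∑ i, c i * ∫ x in M.cell i, f x := by
  rw [l2pair, M.integral_eq_sum (integrable_mul_test hf (memLp_step c))]
  refine Finset.sum_congr rfl fun i _ => ?_
  rw [← integral_const_mul]
  refine setIntegral_congr_fun measurableSet_Ioo fun x hx => ?_
  simp only [step_apply c hx, mul_comm]

variable (M) in
/-- The mean value of `f` on a cell. -/
def avg (f : ℝ → ℝ) (i : Fin M.l) : ℝ := (M.len i)⁻¹ * ∫ x in M.cell i, f x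

lemma integral_cell_const (i : Fin M.l) (c : ℝ) : ∫ _ in M.cell i, c = M.len i * c := by
  rw [setIntegral_const, cell, measureReal_def, Real.volume_Ioo, ENNReal.toReal_ofReal, len, smul_eq_mul]
  exact (M.len_pos i).le

lemma integral_cell_step (c : Fin M.l → ℝ) (i : Fin M.l) :
    ∫ x in M.cell i, M.step c x = M.len i * c i := by
  rw [← integral_cell_const]
  exact setIntegral_congr_fun measurableSet_Ioo fun x hx => step_apply c hx

lemma len_mul_avg (f : ℝ → ℝ) (i : Fin M.l) : M.len i * M.avg f i = ∫ x in M.cell i, f x :=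
  mul_inv_cancel_left₀ (M.len_pos i).ne' _

lemma integral_cell_sub_avg {f : ℝ → ℝ} (hf : Integrable f lebΩ) (i : Fin M.l) :
    ∫ x in M.cell i, (f x - M.step (M.avg f) x) = 0 := by
  rw [integral_sub (M.integrableOn_cell hf i)
    (M.integrableOn_cell (memLp_step _).top_to_two.to_integrable i), integral_cell_step,
    len_mul_avg, sub_self]

/-- Cell averaging is symmetric: either side is the sum over cells of the product of the two
integrals divided by the length. -/
lemma l2pair_avg_comm {f g : ℝ → ℝ} (hf : Integrable f lebΩ) (hg : Integrable g lebΩ) :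
    l2pair f (M.step (M.avg g)) = l2pair (M.step (M.avg f)) g := by
  rw [l2pair_comm _ g, l2pair_step hf, l2pair_step hg]
  refine Finset.sum_congr rfl fun i _ => ?_
  rw [avg, avg]; ring

lemma integral_avg {f : ℝ → ℝ} (hf : Integrable f lebΩ) :
    ∫ x, M.step (M.avg f) x ∂lebΩ = ∫ x, f x ∂lebΩ := by
  rw [M.integral_eq_sum hf, M.integral_eq_sum (memLp_step _).top_to_two.to_integrable]
  exact Finset.sum_congr rfl fun i _ => by rw [integral_cell_step, len_mul_avg]

/-- For a remainder with zero cell means, the primitive starts afresh at every node. This gains one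
power of the distance to the nodes, in the Ritz estimate as well as in the averaging estimate for BV
functions. -/
lemma prim_node_eq_zero {f : ℝ → ℝ} (hf : Integrable f lebΩ)
    (h0 : ∀ i, ∫ x in M.cell i, f x = 0) (j : Fin (M.l + 1)) : prim f (M.node j) = 0 := by
  induction j using Fin.induction with
  | zero => rw [M.node_zero, prim_zero]
  | succ i ih =>
    have h := prim_sub_prim hf (M.node_mem_Icc i.castSucc) (M.node_mem_Icc i.succ)
    rw [ih, sub_zero] at h
    rw [h, intervalIntegral.integral_of_le (M.node_lt i).le, integral_Ioc_eq_integral_Ioo]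
    exact h0 i

lemma abs_avg_sub_le {g : ℝ → ℝ} (hg : Integrable g lebΩ) {i : Fin M.l} {x B : ℝ}
    (hB : ∀ y ∈ M.cell i, |g y - g x| ≤ B) : |M.avg g i - g x| ≤ B := by
  have h1 : M.avg g i - g x = (M.len i)⁻¹ * ∫ y in M.cell i, (g y - g x) := by
    rw [integral_sub (M.integrableOn_cell hg i) (M.integrableOn_cell (integrable_const _) i),
      integral_cell_const, mul_sub, inv_mul_cancel_left₀ (M.len_pos i).ne', avg]
  have h2 : ‖∫ y in M.cell i, (g y - g x)‖ ≤ B * M.len i := by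
    have := norm_setIntegral_le_of_norm_le_const (μ := volume) (s := M.cell i)
      (f := fun y => g y - g x) (C := B) (by simp [cell]) hB
    rwa [measureReal_def, cell, Real.volume_Ioo, ENNReal.toReal_ofReal] at this
    exact (M.len_pos i).le
  rw [h1, abs_mul, abs_of_pos (inv_pos.2 (M.len_pos i)), inv_mul_le_iff₀ (M.len_pos i), mul_comm]
  exact h2

lemma abs_sub_le_width {i : Fin M.l} {x y : ℝ} (hx : x ∈ M.cell i) (hy : y ∈ M.cell i) :
    |y - x| ≤ M.width := by
  refine le_trans ?_ (M.len_le_width i)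
  rw [len, abs_le]
  have := hx.1; have := hx.2; have := hy.1; have := hy.2
  constructor <;> linarith

end Mesh

/-! ### Finite element functions -/

/-- Continuity upgrades v = prim dv from almost everywhere to all of Ω, so `dv` can be compared with
the slope of `v` at almost every point of a cell. -/
lemma IsFE.exists_step {M : Mesh} {v dv : ℝ → ℝ} (h : IsFE M v dv) :
    ∃ c, dv =ᵐ[lebΩ] M.step c := by
  choose m c hmc using h.affine
  refine ⟨m, ?_⟩
  have hv : Set.EqOn v (prim dv) Ω := Measure.eqOn_open_of_ae_eq h.isH10.ae_eq_prim isOpen_Ioo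
    (h.continuousOn.mono Ω_subset_Icc) ((prim_continuousOn h.isH10.integrable_deriv).mono Ω_subset_Icc)
  filter_upwards [M.ae_mem_cell, prim_hasDerivAt h.isH10.integrable_deriv] with x ⟨i, hi⟩ hx
  rw [Mesh.step_apply m hi]
  have h1 : HasDerivAt (fun x => m i * x + c i) (m i) x := by
    simpa using ((hasDerivAt_id x).const_mul (m i)).add_const (c i)
  refine hx.unique (h1.congr_of_eventuallyEq ?_)
  filter_upwards [isOpen_Ioo.mem_nhds hi] with y hy
  rw [← hv (M.cell_subset_Ω i hy), hmc i y hy]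

lemma isFE_prim {M : Mesh} {k : ℝ → ℝ} (hk : MemLp k 2 lebΩ) (h0 : ∫ x, k x ∂lebΩ = 0)
    {c : Fin M.l → ℝ} (hc : k =ᵐ[lebΩ] M.step c) : IsFE M (prim k) k where
  isH10 := isH10_prim hk h0
  continuousOn := prim_continuousOn hk.to_integrable
  zero_left := prim_zero k
  zero_right := by rw [prim_one, h0]
  affine i := by
    refine ⟨c i, prim k (M.node i.castSucc) - c i * M.node i.castSucc, fun x hx => ?_⟩
    have hn := M.node_mem_Icc i.castSucc
    have hx' := Ω_subset_Icc (M.cell_subset_Ω i hx)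
    have h1 := prim_sub_prim hk.to_integrable hn hx'
    have h2 : ∫ s in (M.node i.castSucc)..x, k s = ∫ s in (M.node i.castSucc)..x, c i := by
      refine intervalIntegral.integral_congr_ae ?_
      filter_upwards [ae_imp_of_ae hc] with s hs hs'
      rw [hs (Ioc_subset_of_mem hn hx' hs')]
      rw [Set.uIoc_of_le hx.1.le] at hs'
      exact Mesh.step_apply c ⟨hs'.1, hs'.2.trans_lt hx.2⟩
    rw [h2, intervalIntegral.integral_const, smul_eq_mul] at h1
    linarith

lemma IsFE.sub_prim {M : Mesh} {v dv w dw : ℝ → ℝ} (h : IsFE M v dv) (h' : IsFE M w dw) :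
    IsFE M (prim fun x => dv x - dw x) (fun x => dv x - dw x) := by
  obtain ⟨c, hc⟩ := h.exists_step
  obtain ⟨c', hc'⟩ := h'.exists_step
  refine isFE_prim (c := fun i => c i - c' i) (h.isH10.memLp_deriv.sub h'.isH10.memLp_deriv) ?_ ?_
  · rw [integral_sub h.isH10.integrable_deriv h'.isH10.integrable_deriv, h.isH10.integral_deriv,
      h'.isH10.integral_deriv, sub_zero]
  · filter_upwards [hc, hc', M.ae_mem_cell] with x h1 h2 ⟨i, hi⟩
    rw [h1, h2, Mesh.step_apply _ hi, Mesh.step_apply _ hi, Mesh.step_apply _ hi]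

/-- The weak derivatives of finite element functions. -/
def feSpace (M : Mesh) : Submodule ℝ (Lp ℝ 2 lebΩ) :=
  LinearMap.range (⟨⟨fun c => (Mesh.memLp_step (M := M) c).top_to_two.toLp (M.step c), fun c c' => by
    rw [← MemLp.toLp_add, MemLp.toLp_eq_toLp_iff]
    filter_upwards [M.ae_mem_cell] with x ⟨i, hi⟩
    simp [Mesh.step_apply _ hi]⟩, fun r c => by
    rw [RingHom.id_apply, ← MemLp.toLp_const_smul, MemLp.toLp_eq_toLp_iff]
    filter_upwards [M.ae_mem_cell] with x ⟨i, hi⟩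
    simp [Mesh.step_apply _ hi]⟩ : (Fin M.l → ℝ) →ₗ[ℝ] Lp ℝ 2 lebΩ) ⊓ zeroMean

lemma mem_feSpace {M : Mesh} {F : Lp ℝ 2 lebΩ} :
    F ∈ feSpace M ↔ (∃ c, F =ᵐ[lebΩ] M.step c) ∧ ∫ x, F x ∂lebΩ = 0 := by
  rw [feSpace, Submodule.mem_inf, mem_zeroMean]
  refine and_congr_left fun _ => ⟨?_, ?_⟩
  · rintro ⟨c, rfl⟩
    exact ⟨c, MemLp.coeFn_toLp (Mesh.memLp_step c).top_to_two⟩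
  · rintro ⟨c, hc⟩
    exact ⟨c, Lp.ext ((MemLp.coeFn_toLp (Mesh.memLp_step c).top_to_two).trans hc.symm)⟩

instance (M : Mesh) : CompleteSpace (feSpace M) := by
  have : FiniteDimensional ℝ (feSpace M) := by
    rw [feSpace]; exact Submodule.finiteDimensional_inf_left _ _
  exact FiniteDimensional.complete ℝ _

lemma isFE_of_mem_feSpace {M : Mesh} {F : Lp ℝ 2 lebΩ} (hF : F ∈ feSpace M) :
    IsFE M (prim F) F :=
  let ⟨⟨_, hc⟩, h0⟩ := mem_feSpace.1 hF
  isFE_prim (Lp.memLp F) h0 hc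

lemma IsFE.toLp_mem {M : Mesh} {v dv : ℝ → ℝ} (h : IsFE M v dv) :
    h.isH10.memLp_deriv.toLp dv ∈ feSpace M := by
  obtain ⟨c, hc⟩ := h.exists_step
  exact mem_feSpace.2 ⟨⟨c, (MemLp.coeFn_toLp _).trans hc⟩, by
    rw [integral_toLp, h.isH10.integral_deriv]⟩

/-! ### Existence of discrete states and Ritz projections -/

section Galerkin

variable {a d₀ : ℝ → ℝ} {K : ℝ≥0} {ν : ℝ}

lemma IsElliptic.exists_discreteState (h : IsElliptic a d₀ K ν) (M : Mesh) {p : ℝ → ℝ}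
    (hp : Integrable p lebΩ) : ∃ u, IsDiscreteState a d₀ M p u := by
  obtain ⟨F, hF⟩ := exists_clm_l2pair_prim hp
  obtain ⟨k, hk, hkl⟩ := h.exists_solution (feSpace M) F
  refine ⟨prim k, k, isFE_of_mem_feSpace hk, fun w dw hw => ?_⟩
  rw [bform_eq_toLp _ hw.isH10, hkl _ hw.toLp_mem, hF, l2pair_eq_toLp _ hw.isH10]

/-- `yh` is the Ritz projection of `y` onto `V_h`. -/
structure IsRitz (a d₀ : ℝ → ℝ) (M : Mesh) (y dy yh dyh : ℝ → ℝ) : Prop where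
  isFE : IsFE M yh dyh
  eq : ∀ w dw, IsFE M w dw → bform a d₀ yh dyh w dw = bform a d₀ y dy w dw

lemma IsElliptic.exists_ritz (h : IsElliptic a d₀ K ν) (M : Mesh) {y dy : ℝ → ℝ}
    (hy : IsH10 y dy) : ∃ yh dyh, IsRitz a d₀ M y dy yh dyh := by
  obtain ⟨B, hB⟩ := h.exists_clm
  obtain ⟨k, hk, hkl⟩ := h.exists_solution (feSpace M) (B (hy.memLp_deriv.toLp dy))
  refine ⟨prim k, k, isFE_of_mem_feSpace hk, fun w dw hw => ?_⟩
  rw [bform_eq_toLp _ hw.isH10, hkl _ hw.toLp_mem, hB, ← bform_eq_toLp _ hw.isH10]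
  exact bform_congr ((prim_toLp _).trans hy.ae_eq_prim.symm) hy.memLp_deriv.coeFn_toLp
    (ae_eq_refl _) (ae_eq_refl _)

end Galerkin

/-! ### Regularity -/

lemma exists_lipschitzOnWith {f : ℝ → ℝ} (L : ℝ)
    (h : ∀ x ∈ Set.Icc (0 : ℝ) 1, ∀ y ∈ Set.Icc (0 : ℝ) 1, |f x - f y| ≤ L * |x - y|) :
    ∃ L' : ℝ≥0, LipschitzOnWith L' f (Set.Icc 0 1) := by
  refine ⟨L.toNNReal, LipschitzOnWith.of_dist_le_mul fun x hx y hy => ?_⟩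
  rw [Real.dist_eq, Real.dist_eq]
  exact (h x hx y hy).trans (mul_le_mul_of_nonneg_right (Real.le_coe_toNNReal L) (abs_nonneg _))

lemma abs_sub_le_of_lip {f : ℝ → ℝ} {L : ℝ≥0} (h : LipschitzOnWith L f (Set.Icc 0 1)) {x y : ℝ}
    (hx : x ∈ Set.Icc (0 : ℝ) 1) (hy : y ∈ Set.Icc (0 : ℝ) 1) : |f x - f y| ≤ L * |x - y| := by
  simpa [Real.dist_eq] using h.dist_le_mul x hx y hy

lemma exists_lip_mul {f g : ℝ → ℝ} {L L' : ℝ≥0} (hf : LipschitzOnWith L f (Set.Icc 0 1))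
    (hg : LipschitzOnWith L' g (Set.Icc 0 1)) :
    ∃ L'' : ℝ≥0, LipschitzOnWith L'' (fun x => f x * g x) (Set.Icc 0 1) := by
  obtain ⟨A, hA0, hA⟩ := exists_bound_of_continuousOn hf.continuousOn
  obtain ⟨B, hB0, hB⟩ := exists_bound_of_continuousOn hg.continuousOn
  refine exists_lipschitzOnWith (A * L' + B * L) fun x hx y hy => ?_
  have h1 : f x * g x - f y * g y = f x * (g x - g y) + g y * (f x - f y) := by ring
  rw [h1]
  refine (abs_add_le _ _).trans ?_
  rw [abs_mul, abs_mul, add_mul, mul_assoc, mul_assoc]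
  exact add_le_add (mul_le_mul (hA x hx) (abs_sub_le_of_lip hg hx hy) (abs_nonneg _) hA0)
    (mul_le_mul (hB y hy) (abs_sub_le_of_lip hf hx hy) (abs_nonneg _) hB0)

section

variable {a d₀ : ℝ → ℝ} {K : ℝ≥0} {ν : ℝ}

lemma IsElliptic.exists_lip_inv (h : IsElliptic a d₀ K ν) :
    ∃ L : ℝ≥0, LipschitzOnWith L (fun x => (a x)⁻¹) (Set.Icc 0 1) := by
  refine exists_lipschitzOnWith (K / ν ^ 2) fun x hx y hy => ?_
  have hν := h.pos
  have h1 := h.ge x hx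
  have h2 := h.ge y hy
  have h1' : 0 < a x := hν.trans_le h1
  have h2' : 0 < a y := hν.trans_le h2
  rw [inv_sub_inv h1'.ne' h2'.ne', abs_div, abs_of_pos (mul_pos h1' h2'), abs_sub_comm,
    div_mul_eq_mul_div]
  refine div_le_div₀ (by positivity) (abs_sub_le_of_lip h.lip hx hy) (by positivity) ?_
  rw [pow_two]
  exact mul_le_mul h1 h2 hν.le h1'.le

lemma IsTestFun.isH10 {φ : ℝ → ℝ} (hφ : IsTestFun φ) : IsH10 φ (deriv φ) := by
  have h : φ = prim (deriv φ) := funext hφ.eq_prim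
  have h2 := isH10_prim hφ.deriv_isTestFun.memLp_two hφ.integral_deriv
  rwa [← h] at h2

lemma IsH10.memLp_top {v dv : ℝ → ℝ} (h : IsH10 v dv) : MemLp v ⊤ lebΩ :=
  (memLp_top_prim h.integrable_deriv).ae_eq h.ae_eq_prim.symm

/-- Solutions with bounded right hand side have a Lipschitz continuous derivative. -/
lemma IsElliptic.exists_lip_deriv (h : IsElliptic a d₀ K ν) {y dy f : ℝ → ℝ} (hy : IsH10 y dy)
    (hf : MemLp f ⊤ lebΩ) (hyf : ∀ w dw, IsH10 w dw → bform a d₀ w dw y dy = l2pair w f) :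
    ∃ (L : ℝ≥0) (g : ℝ → ℝ), LipschitzOnWith L g (Set.Icc 0 1) ∧ dy =ᵐ[lebΩ] g := by
  have hdy : MemLp (fun x => d₀ x * y x) ⊤ lebΩ := hy.memLp_top.mul (r := ⊤) h.memLp
  have hm : MemLp (fun x => d₀ x * y x - f x) ⊤ lebΩ := hdy.sub hf
  have hmi := hm.top_to_two.to_integrable
  have hady : MemLp (fun x => a x * dy x) 2 lebΩ := memLp_two_mul_of_bdd h.memLp_a hy.memLp_deriv
  have hF2 := memLp_two_prim hm.top_to_two
  -- The weak equation reads (a y')' = d₀ y - f, so a y' differs from a primitive of the bounded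
  -- function d₀ y - f by a constant. Dividing by the Lipschitz function `a` gives the claim.
  obtain ⟨c, hc⟩ := ae_eq_const_of_l2pair_deriv
    (f := fun x => a x * dy x - prim (fun x => d₀ x * y x - f x) x)
    (hady.sub hF2).to_integrable fun φ hφ => by
      have h1 := hyf φ _ hφ.isH10
      have hφ' := hφ.deriv_isTestFun
      rw [bform] at h1
      have e1 : l2pair (fun x => a x * deriv φ x) dy = l2pair (fun x => a x * dy x) (deriv φ) := by
        simp only [l2pair]; congr 1; funext x; ring
      have e2 : l2pair (fun x => d₀ x * φ x) y - l2pair φ f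
          = l2pair φ (fun x => d₀ x * y x - f x) := by
        rw [l2pair_sub_right hφ.memLp_two hdy.top_to_two hf.top_to_two]
        simp only [l2pair]; congr 2; funext x; ring
      have e3 := integral_prim_mul hφ'.integrable hmi
      simp only [← hφ.eq_prim] at e3
      rw [hφ.eq_zero (x := 1) (by simp [Ω]), zero_mul, zero_sub] at e3
      rw [l2pair_sub_left hφ'.memLp_two hady hF2, l2pair_comm (prim _)]
      have e4 : l2pair φ (fun x => d₀ x * y x - f x)
        = - l2pair (deriv φ) (prim fun x => d₀ x * y x - f x) := e3
      linarith
  obtain ⟨B, hB0, hB⟩ := exists_bound_of_memLp_top hm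
  obtain ⟨L₁, hL₁⟩ := exists_lipschitzOnWith (f := fun x => prim (fun x => d₀ x * y x - f x) x + c) B
    fun x hx y hy => by
      simpa using abs_prim_sub_prim_le hmi hB hy hx
  obtain ⟨L₂, hL₂⟩ := h.exists_lip_inv
  obtain ⟨L, hL⟩ := exists_lip_mul hL₁ hL₂
  refine ⟨L, _, hL, ?_⟩
  filter_upwards [hc, ae_mem_Icc] with x hx hx'
  have : 0 < a x := h.pos.trans_le (h.ge x hx')
  rw [← hx]
  field_simp
  ring

/-- Testing with a fixed smooth function is continuous with respect to the `L²` norm. -/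
lemma IsElliptic.exists_bform_test_le (h : IsElliptic a d₀ K ν) {ψ : ℝ → ℝ} (hψ : IsTestFun ψ) :
    ∃ C, 0 ≤ C ∧ ∀ v dv, IsH10 v dv → |bform a d₀ v dv ψ (deriv ψ)| ≤ C * l2norm v := by
  obtain ⟨L₁, hL₁⟩ := hψ.deriv_isTestFun.smooth.lipschitzWith_of_hasCompactSupport
    hψ.deriv_isTestFun.compact (by simp)
  obtain ⟨L, hL⟩ := exists_lip_mul h.lip (hL₁.lipschitzOnWith (s := Set.Icc 0 1))
  obtain ⟨D, hD0, hD⟩ := exists_bound_of_memLp_top h.memLp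
  refine ⟨L + D * l2norm ψ, by have := l2norm_nonneg ψ; positivity, fun v dv hv => ?_⟩
  rw [bform, add_mul]
  refine (abs_add_le _ _).trans (add_le_add ?_ ?_)
  · have h1 := abs_integral_mul_lipschitz_le hv.integrable_deriv
      (by rw [prim_one, hv.integral_deriv]) hL
    have e1 : l2pair (fun x => a x * dv x) (deriv ψ) = ∫ x, dv x * (a x * deriv ψ x) ∂lebΩ := by
      simp only [l2pair]; congr 1; funext x; ring
    rw [e1]
    refine h1.trans (mul_le_mul_of_nonneg_left ?_ L.2)
    rw [l2norm_congr hv.ae_eq_prim]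
    exact integral_abs_le_l2norm (memLp_two_prim hv.memLp_deriv)
  · refine (abs_l2pair_le (memLp_two_mul_of_bdd h.memLp hv.memLp) hψ.memLp_two).trans ?_
    have := l2norm_mul_le hD0 hD hv.memLp
    have h3 := l2norm_nonneg ψ
    nlinarith

/-! ### The Ritz projection -/

/-- Maximum norm estimate for the Ritz projection. -/
lemma IsElliptic.exists_ritz_le (h : IsElliptic a d₀ K ν) {y dy g : ℝ → ℝ} {L : ℝ≥0}
    (hy : IsH10 y dy) (hg : LipschitzOnWith L g (Set.Icc 0 1)) (hyg : dy =ᵐ[lebΩ] g) :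
    ∃ C, 0 ≤ C ∧ ∀ M yh dyh, IsRitz a d₀ M y dy yh dyh →
      ∀ᵐ x ∂lebΩ, |y x - yh x| ≤ C * M.width ^ 2 := by
  obtain ⟨D, hD0, hD⟩ := exists_bound_of_memLp_top h.memLp
  have hν := h.pos
  have hL0 := L.2
  have hK0 := K.2
  refine ⟨L + (K * L + D * L) / ν, by positivity, fun M yh dyh hR => ?_⟩
  set H := M.width with hH
  have hH0 : 0 < H := M.width_pos
  have hg2 : MemLp g 2 lebΩ := (memLp_top_of_continuousOn hg.continuousOn).top_to_two
  have hgi := hg2.to_integrable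
  -- As `k` averages y' over cells, `prim k` is the nodal interpolant of `y`. The interpolation
  -- error `prim r` is of order H², because `r` is of order H with zero mean on each cell.
  set k := M.step (M.avg g) with hk
  have hk2 : MemLp k 2 lebΩ := (Mesh.memLp_step _).top_to_two
  have hg0 : ∫ x, g x ∂lebΩ = 0 := by rw [← integral_congr_ae hyg, hy.integral_deriv]
  have hkFE : IsFE M (prim k) k :=
    isFE_prim hk2 (by rw [hk, Mesh.integral_avg hgi, hg0]) (ae_eq_refl _)
  set r : ℝ → ℝ := fun x => g x - k x with hr
  have hr2 : MemLp r 2 lebΩ := hg2.sub hk2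
  have hrb : ∀ᵐ x ∂lebΩ, |r x| ≤ L * H := by
    filter_upwards [M.ae_mem_cell] with x ⟨i, hi⟩
    rw [hr]
    simp only [hk, Mesh.step_apply _ hi]
    rw [abs_sub_comm]
    refine Mesh.abs_avg_sub_le hgi fun y hy' => ?_
    refine (abs_sub_le_of_lip hg (Ω_subset_Icc (M.cell_subset_Ω i hy'))
      (Ω_subset_Icc (M.cell_subset_Ω i hi))).trans ?_
    exact mul_le_mul_of_nonneg_left (Mesh.abs_sub_le_width hi hy') hL0
  have hrc : ∀ i, ∫ x in M.cell i, r x = 0 := Mesh.integral_cell_sub_avg hgi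
  have hpr : ∀ᵐ x ∂lebΩ, |prim r x| ≤ L * H ^ 2 := by
    filter_upwards [M.ae_mem_cell] with x ⟨i, hi⟩
    have hn := Mesh.prim_node_eq_zero hr2.to_integrable hrc i.castSucc
    have h1 := abs_prim_sub_prim_le hr2.to_integrable hrb (M.node_mem_Icc i.castSucc)
      (Ω_subset_Icc (M.cell_subset_Ω i hi))
    rw [hn, sub_zero] at h1
    refine h1.trans ?_
    rw [pow_two, ← mul_assoc]
    refine mul_le_mul_of_nonneg_left ?_ (by positivity)
    rw [abs_of_pos (sub_pos.2 hi.1)]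
    refine le_trans ?_ (M.len_le_width i)
    have := hi.2
    rw [Mesh.len]; linarith
  set dw : ℝ → ℝ := fun x => k x - dyh x with hdw
  have hwFE : IsFE M (prim dw) dw := hkFE.sub_prim hR.isFE
  have hdw2 := hwFE.isH10.memLp_deriv
  have hpk : ∀ {k : ℝ → ℝ}, MemLp k 2 lebΩ → MemLp (prim k) 2 lebΩ := memLp_two_prim
  have hdyh2 := hR.isFE.isH10.memLp_deriv
  -- Galerkin orthogonality: the difference between interpolant and Ritz projection, a finite
  -- element function, is driven only by the interpolation error.
  have hkey : bform a d₀ (prim dw) dw (prim dw) dw = - bform a d₀ (prim r) r (prim dw) dw := by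
    have e1 : bform a d₀ (prim dw) dw (prim dw) dw
        = bform a d₀ (prim k) k (prim dw) dw - bform a d₀ yh dyh (prim dw) dw := by
      rw [← bform_sub_left h (hpk hdw2) hdw2 (hpk hk2) hk2 hR.isFE.isH10.memLp hdyh2]
      refine bform_congr ?_ (ae_eq_refl _) (ae_eq_refl _) (ae_eq_refl _)
      filter_upwards [hR.isFE.isH10.ae_eq_prim, ae_mem_Icc] with x h1 h2
      rw [h1, hdw, prim_sub hk2.to_integrable hdyh2.to_integrable h2]
    have e2 : bform a d₀ (prim r) r (prim dw) dw
        = bform a d₀ y dy (prim dw) dw - bform a d₀ (prim k) k (prim dw) dw := by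
      rw [← bform_sub_left h (hpk hdw2) hdw2 hy.memLp hy.memLp_deriv (hpk hk2) hk2]
      refine bform_congr ?_ ?_ (ae_eq_refl _) (ae_eq_refl _)
      · filter_upwards [hy.ae_eq_prim, ae_mem_Icc] with x h1 h2
        rw [h1, hr, prim_sub hgi hk2.to_integrable h2, prim_congr hyg h2]
      · filter_upwards [hyg] with x hx
        rw [hx]
    rw [e1, e2, hR.eq _ _ hwFE]; ring
  obtain ⟨c, hc⟩ := hwFE.exists_step
  -- Directly, this term is only of order H. But `dw` is constant on cells and `r` has zero mean
  -- there, so `a` may be replaced by its deviation from the left nodal value, which supplies the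
  -- second factor H.
  have hfirst : |l2pair (fun x => a x * r x) dw| ≤ (K * H) * (L * H) * l2norm dw := by
    set b := M.step fun i => a (M.node i.castSucc) with hb
    have hbt : MemLp b ⊤ lebΩ := Mesh.memLp_step _
    have hz : l2pair (fun x => b x * r x) dw = 0 := by
      have e : l2pair (fun x => b x * r x) dw
          = l2pair r (M.step fun i => a (M.node i.castSucc) * c i) := by
        refine integral_congr_ae ?_
        filter_upwards [hc, M.ae_mem_cell] with x h1 ⟨i, hi⟩
        simp only [h1, hb, Mesh.step_apply _ hi]; ring
      rw [e, Mesh.l2pair_step hr2.to_integrable]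
      simp [hrc]
    have e : l2pair (fun x => a x * r x) dw = l2pair (fun x => (a x - b x) * r x) dw := by
      have := l2pair_sub_left hdw2 (memLp_two_mul_of_bdd h.memLp_a hr2) (memLp_two_mul_of_bdd hbt hr2)
      rw [hz, sub_zero] at this
      rw [← this]; simp only [sub_mul]
    rw [e]
    refine (abs_l2pair_le (memLp_two_mul_of_bdd (h.memLp_a.sub hbt) hr2) hdw2).trans ?_
    refine mul_le_mul_of_nonneg_right ?_ (l2norm_nonneg _)
    refine l2norm_le_of_bound (by positivity) ?_
    filter_upwards [hrb, M.ae_mem_cell] with x h1 ⟨i, hi⟩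
    rw [abs_mul]
    refine mul_le_mul ?_ h1 (abs_nonneg _) (by positivity)
    rw [Pi.sub_apply, hb, Mesh.step_apply _ hi]
    refine (abs_sub_le_of_lip h.lip (Ω_subset_Icc (M.cell_subset_Ω i hi))
      (M.node_mem_Icc _)).trans (mul_le_mul_of_nonneg_left ?_ hK0)
    rw [abs_of_pos (sub_pos.2 hi.1)]
    refine le_trans ?_ (M.len_le_width i)
    have := hi.2
    rw [Mesh.len]; linarith
  have hsecond : |l2pair (fun x => d₀ x * prim r x) (prim dw)| ≤ D * (L * H ^ 2) * l2norm dw := by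
    refine (abs_l2pair_le (memLp_two_mul_of_bdd h.memLp (hpk hr2)) (hpk hdw2)).trans ?_
    refine mul_le_mul ?_ (l2norm_prim_le hdw2) (l2norm_nonneg _) (by positivity)
    exact (l2norm_mul_le hD0 hD (hpk hr2)).trans
      (mul_le_mul_of_nonneg_left (l2norm_le_of_bound (by positivity) hpr) hD0)
  have hco := h.coercive (prim dw) hdw2
  have hn := l2norm_nonneg dw
  have hbound : l2norm dw ≤ (K * L + D * L) / ν * H ^ 2 := by
    rw [hkey, bform] at hco
    have h1 := neg_le_of_abs_le hfirst
    have h2 := neg_le_of_abs_le hsecond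
    rw [div_mul_eq_mul_div, le_div_iff₀ hν]
    rcases hn.eq_or_lt with h0 | h0
    · rw [← h0, zero_mul]; positivity
    · have : l2norm dw * (l2norm dw * ν) ≤ l2norm dw * ((K * L + D * L) * H ^ 2) := by nlinarith
      exact le_of_mul_le_mul_left this h0
  filter_upwards [hpr, hy.ae_eq_prim, hR.isFE.isH10.ae_eq_prim, ae_mem_Icc] with x h1 h2 h3 h4
  have h5 := abs_prim_le_l2norm hdw2 h4
  have e1 : prim r x = y x - prim k x := by
    rw [h2, hr, prim_sub hgi hk2.to_integrable h4, prim_congr hyg h4]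
  have e2 : prim dw x = prim k x - yh x := by
    rw [h3, hdw, prim_sub hk2.to_integrable hdyh2.to_integrable h4]
  have e3 : y x - yh x = prim r x + prim dw x := by rw [e1, e2]; ring
  rw [e3, add_mul]
  exact (abs_add_le _ _).trans (add_le_add h1 (h5.trans hbound))

end

/-! ### The space `BV(Ω)` -/

lemma MemBV.integrable_mul_deriv {q φ : ℝ → ℝ} (hq : MemBV q) (hφ : IsTestFun φ) :
    Integrable (fun x => q x * deriv φ x) lebΩ :=
  integrable_mul_test hq.integrable hφ.deriv_isTestFun.memLp_top

lemma MemBV.abs_l2pair_deriv_le_tv {q φ : ℝ → ℝ} (hq : MemBV q) (hφ : IsTestFun φ)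
    (h1 : ∀ x, |φ x| ≤ 1) : |l2pair q (deriv φ)| ≤ tv q := by
  simpa using hq.abs_l2pair_deriv_le hφ zero_le_one h1

lemma MemBV.add_smul {q p : ℝ → ℝ} (hq : MemBV q) (hp : MemBV p) (t : ℝ) :
    MemBV (fun x => q x + t * p x) ∧ tv (fun x => q x + t * p x) ≤ tv q + |t| * tv p := by
  have h0 : 0 ≤ tv q + |t| * tv p := by
    have := tv_nonneg q; have := tv_nonneg p; positivity
  have h := tv_le_of_forall (q := fun x => q x + t * p x) h0 fun φ hφ hφ1 => by
    have e : l2pair (fun x => q x + t * p x) (deriv φ)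
        = l2pair q (deriv φ) + t * l2pair p (deriv φ) := by
      rw [l2pair, l2pair, l2pair, ← integral_const_mul, ← integral_add (hq.integrable_mul_deriv hφ)
        ((hp.integrable_mul_deriv hφ).const_mul t)]
      congr 1; funext x; ring
    rw [e]
    have h1 := (le_abs_self _).trans (hq.abs_l2pair_deriv_le_tv hφ hφ1)
    have h2 := hp.abs_l2pair_deriv_le_tv hφ hφ1
    have h3 : t * l2pair p (deriv φ) ≤ |t| * tv p := by
      refine (le_abs_self _).trans ?_
      rw [abs_mul]; exact mul_le_mul_of_nonneg_left h2 (abs_nonneg t)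
    linarith
  exact ⟨⟨hq.integrable.add (hp.integrable.const_mul t), h.1.trans_lt ENNReal.ofReal_lt_top⟩, h.2⟩

lemma memBV_const (c : ℝ) : MemBV (fun _ => c) ∧ tv (fun _ => c) = 0 := by
  have h := tv_le_of_forall (q := fun _ => c) le_rfl fun φ hφ hφ1 => by
    rw [l2pair, integral_const_mul, hφ.integral_deriv, mul_zero]
  exact ⟨⟨integrable_const c, h.1.trans_lt ENNReal.ofReal_lt_top⟩, le_antisymm h.2 (tv_nonneg _)⟩

lemma MemBV.smul {q : ℝ → ℝ} (hq : MemBV q) (t : ℝ) :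
    MemBV (fun x => t * q x) ∧ tv (fun x => t * q x) ≤ |t| * tv q := by
  simpa [(memBV_const 0).2] using (memBV_const 0).1.add_smul hq t

lemma integral_indicator_Ioi {f : ℝ → ℝ} (hf : Integrable f lebΩ) {x : ℝ}
    (hx : x ∈ Set.Icc (0 : ℝ) 1) :
    l2pair ((Set.Ioi x).indicator fun _ => 1) f = prim f 1 - prim f x := by
  rw [prim_sub_prim hf hx one_mem_Icc, intervalIntegral.integral_of_le hx.2, l2pair]
  have : ∀ s, (Set.Ioi x).indicator (fun _ => (1 : ℝ)) s * f s = (Set.Ioi x).indicator f s := by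
    intro s; by_cases hs : s ∈ Set.Ioi x <;> simp [hs]
  simp_rw [this]
  rw [integral_indicator measurableSet_Ioi, lebΩ_eq_Ioc, Measure.restrict_restrict measurableSet_Ioi,
    Set.inter_comm, Set.Ioc_inter_Ioi, max_eq_right hx.1]

/-- Unit jumps are the controls that reveal point values of the multiplier. -/
lemma memBV_indicator_Ioi {x : ℝ} (hx : x ∈ Set.Icc (0 : ℝ) 1) :
    MemBV ((Set.Ioi x).indicator fun _ => 1) ∧ tv ((Set.Ioi x).indicator fun _ => 1) ≤ 1 := by
  have h := tv_le_of_forall (q := (Set.Ioi x).indicator fun _ => 1) zero_le_one fun φ hφ hφ1 => by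
    rw [integral_indicator_Ioi hφ.deriv_isTestFun.integrable hx, ← hφ.eq_prim, ← hφ.eq_prim,
      hφ.eq_zero (x := 1) (by simp [Ω]), zero_sub]
    exact (neg_le_abs _).trans (hφ1 x)
  exact ⟨⟨(integrable_const (1 : ℝ)).indicator measurableSet_Ioi,
    h.1.trans_lt ENNReal.ofReal_lt_top⟩, h.2⟩

/-! ### Optimality conditions -/

/-- Divide by `t` and let `t` tend to 0; the chosen `t` is small enough for the linear term to
dominate if `P` were negative. -/
lemma nonneg_of_forall_quadratic {P V : ℝ}
    (h : ∀ t ∈ Set.Ioc (0 : ℝ) 1, 0 ≤ t * P + t ^ 2 * V) : 0 ≤ P := by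
  by_contra! hP
  set t := min 1 (-P / (2 * (|V| + 1))) with ht
  have hd : 0 < 2 * (|V| + 1) := by positivity
  have ht0 : 0 < t := lt_min one_pos (div_pos (by linarith) hd)
  have h1 := h t ⟨ht0, min_le_left _ _⟩
  have h2 : t * (2 * (|V| + 1)) ≤ -P := by
    rw [← le_div_iff₀ hd]; exact min_le_right _ _
  have h3 : V ≤ |V| := le_abs_self V
  nlinarith [mul_pos ht0 ht0]

lemma l2norm_add_smul_sq {f v : ℝ → ℝ} (hf : MemLp f 2 lebΩ) (hv : MemLp v 2 lebΩ) (t : ℝ) :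
    l2norm (fun x => f x + t * v x) ^ 2
      = l2norm f ^ 2 + 2 * t * l2pair v f + t ^ 2 * l2norm v ^ 2 := by
  have hv' : MemLp (fun x => t * v x) 2 lebΩ := hv.const_mul t
  have hs : MemLp (fun x => f x + t * v x) 2 lebΩ := hf.add hv'
  rw [l2norm_sq hf, l2norm_sq hv, l2norm_sq hs, l2pair_add_right hs hf hv', l2pair_add_left hf hf hv',
    l2pair_add_left hv' hf hv', l2pair_const_mul_left, l2pair_const_mul_right,
    l2pair_const_mul_left, l2pair_const_mul_right, l2pair_comm f v]
  ring

/-- One-sided derivative at `t = 0` of the tracking term, with the nonsmooth variation term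
majorized by the affine function `T + t * D`. -/
lemma nonneg_of_objective_le {u v ud : ℝ → ℝ} (hu : MemLp u 2 lebΩ) (hv : MemLp v 2 lebΩ)
    (hud : MemLp ud 2 lebΩ) {T D : ℝ}
    (h : ∀ t ∈ Set.Ioc (0 : ℝ) 1, 1 / 2 * l2norm (fun x => u x - ud x) ^ 2 + T
      ≤ 1 / 2 * l2norm (fun x => u x + t * v x - ud x) ^ 2 + (T + t * D)) :
    0 ≤ l2pair v (fun x => u x - ud x) + D := by
  refine nonneg_of_forall_quadratic (V := 1 / 2 * l2norm v ^ 2) fun t ht => ?_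
  have h1 := h t ht
  have e : (fun x => u x + t * v x - ud x) = fun x => (u x - ud x) + t * v x := by
    funext x; ring
  have hm : MemLp (fun x => u x - ud x) 2 lebΩ := hu.sub hud
  rw [e, l2norm_add_smul_sq hm hv] at h1
  nlinarith

lemma isH10_of_ae_eq_prim {v dv : ℝ → ℝ} (hdv : MemLp dv 2 lebΩ) (h0 : ∫ x, dv x ∂lebΩ = 0)
    (h : v =ᵐ[lebΩ] prim dv) : IsH10 v dv where
  memLp := (isH10_prim hdv h0).memLp.ae_eq h.symm
  memLp_deriv := hdv
  weakDeriv φ hφ := by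
    rw [l2pair_congr h (ae_eq_refl _)]
    exact (isH10_prim hdv h0).weakDeriv φ hφ
  approx ε hε := by
    obtain ⟨φ, hφ, h1, h2⟩ := (isH10_prim hdv h0).approx ε hε
    refine ⟨φ, hφ, ?_, h2⟩
    rwa [l2norm_congr (g := fun x => prim dv x - φ x) (h.mono fun x hx => by simp [hx])]

lemma IsH10.add_smul {v dv w dw : ℝ → ℝ} (hv : IsH10 v dv) (hw : IsH10 w dw) (t : ℝ) :
    IsH10 (fun x => v x + t * w x) (fun x => dv x + t * dw x) := by
  have hw' := hw.integrable_deriv.const_mul t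
  refine isH10_of_ae_eq_prim (hv.memLp_deriv.add (hw.memLp_deriv.const_mul t)) ?_ ?_
  · rw [integral_add hv.integrable_deriv hw', integral_const_mul, hv.integral_deriv,
      hw.integral_deriv]; simp
  · filter_upwards [hv.ae_eq_prim, hw.ae_eq_prim, ae_mem_Icc] with x h1 h2 h3
    rw [prim_add hv.integrable_deriv hw' h3, prim_const_mul, h1, h2]

lemma IsFE.add_smul {M : Mesh} {v dv w dw : ℝ → ℝ} (hv : IsFE M v dv) (hw : IsFE M w dw) (t : ℝ) :
    IsFE M (fun x => v x + t * w x) (fun x => dv x + t * dw x) where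
  isH10 := hv.isH10.add_smul hw.isH10 t
  continuousOn := hv.continuousOn.add (hw.continuousOn.const_mul t)
  zero_left := by rw [hv.zero_left, hw.zero_left]; simp
  zero_right := by rw [hv.zero_right, hw.zero_right]; simp
  affine i := by
    obtain ⟨m, c, h⟩ := hv.affine i
    obtain ⟨m', c', h'⟩ := hw.affine i
    exact ⟨m + t * m', c + t * c', fun x hx => by rw [h x hx, h' x hx]; ring⟩

section

variable {a d₀ : ℝ → ℝ} {K : ℝ≥0} {ν : ℝ}

/-- `u` solves the state equation within the class `A` of admissible functions. -/
def SolvesIn (A : (ℝ → ℝ) → (ℝ → ℝ) → Prop) (a d₀ q u : ℝ → ℝ) : Prop :=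
  ∃ du : ℝ → ℝ, A u du ∧ ∀ w dw : ℝ → ℝ, A w dw → bform a d₀ u du w dw = l2pair q w

/-- First order optimality conditions, for the continuous and the discretized problem. -/
lemma IsElliptic.first_order (h : IsElliptic a d₀ K ν) {A : (ℝ → ℝ) → (ℝ → ℝ) → Prop}
    (hA : ∀ w dw, A w dw → IsH10 w dw)
    (hadd : ∀ v dv w dw, A v dv → A w dw → ∀ t : ℝ,
      A (fun x => v x + t * w x) (fun x => dv x + t * dw x))
    (hex : ∀ p, Integrable p lebΩ → ∃ u, SolvesIn A a d₀ p u)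
    {α : ℝ} (hα : 0 < α) {ud q u z dz : ℝ → ℝ} (hud : MemLp ud 2 lebΩ) (hq : MemBV q)
    (hu : SolvesIn A a d₀ q u)
    (hmin : ∀ q' u', MemBV q' → SolvesIn A a d₀ q' u' → objective α ud u q ≤ objective α ud u' q')
    (hz : A z dz)
    (hadj : ∀ w dw, A w dw → bform a d₀ w dw z dz = l2pair w (fun x => u x - ud x)) :
    (∀ p, MemBV p → 0 ≤ l2pair p z + α * tv p) ∧ l2pair q z + α * tv q ≤ 0 := by
  obtain ⟨du, hdu, hsu⟩ := hu
  have hu10 := hA _ _ hdu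
  have hstate : ∀ p v dv, Integrable p lebΩ → A v dv →
      (∀ w dw, A w dw → bform a d₀ v dv w dw = l2pair p w) → ∀ t : ℝ,
      SolvesIn A a d₀ (fun x => q x + t * p x) (fun x => u x + t * v x) := by
    intro p v dv hp hv hvs t
    refine ⟨_, hadd _ _ _ _ hdu hv t, fun w dw hw => ?_⟩
    have hv10 := hA _ _ hv
    have hw10 := hA _ _ hw
    rw [bform_add_left h hw10.memLp hw10.memLp_deriv hu10.memLp hu10.memLp_deriv
      (hv10.memLp.const_mul t) (hv10.memLp_deriv.const_mul t), bform_smul_left, hsu w dw hw,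
      hvs w dw hw, l2pair, l2pair, ← integral_const_mul, ← integral_add
      (integrable_mul_test hq.integrable hw10.memLp_top)
      ((integrable_mul_test hp hw10.memLp_top).const_mul t), l2pair]
    congr 1; funext x; ring
  -- Testing the adjoint equation with `v` and the equation of `v` with `z` turns the derivative in
  -- the state into a pairing of the control direction with `z`.
  have hgrad : ∀ p v dv, A v dv → (∀ w dw, A w dw → bform a d₀ v dv w dw = l2pair p w) →
      l2pair v (fun x => u x - ud x) = l2pair p z := fun p v dv hv hvs => by
    rw [← hadj v dv hv, hvs z dz hz]
  constructor
  · intro p hp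
    obtain ⟨v, dv, hv, hvs⟩ := hex p hp.integrable
    rw [← hgrad p v dv hv hvs]
    -- Perturbation q + t p, whose variation is at most tv q + t tv p.
    refine nonneg_of_objective_le (T := α * tv q) hu10.memLp (hA _ _ hv).memLp hud fun t ht => ?_
    obtain ⟨h1, h2⟩ := hq.add_smul hp t
    have h3 := hmin _ _ h1 (hstate p v dv hp.integrable hv hvs t)
    rw [abs_of_pos ht.1] at h2
    have h4 := mul_le_mul_of_nonneg_left h2 hα.le
    have h5 : objective α ud (fun x => u x + t * v x) (fun x => q x + t * p x)
        = 1 / 2 * l2norm (fun x => u x + t * v x - ud x) ^ 2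
          + α * tv (fun x => q x + t * p x) := rfl
    have h6 : objective α ud u q = 1 / 2 * l2norm (fun x => u x - ud x) ^ 2 + α * tv q := rfl
    rw [h5, h6] at h3
    nlinarith
  -- Perturbation in the direction -q: the control (1 - t) q has variation at most (1 - t) tv q, so
  -- here the variation term has slope -α tv q.
  · have key : 0 ≤ l2pair (fun x => -1 * u x) (fun x => u x - ud x) + -(α * tv q) := by
      refine nonneg_of_objective_le (T := α * tv q) hu10.memLp (hu10.memLp.const_mul (-1)) hud
        fun t ht => ?_
      have hs : SolvesIn A a d₀ (fun x => q x + (-t) * q x) (fun x => u x + (-t) * u x) :=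
        hstate q u du hq.integrable hdu hsu (-t)
      have h0 : ∀ f : ℝ → ℝ, (fun x => f x + -t * f x) = fun x => (1 - t) * f x := fun f => by
        funext x; ring
      rw [h0, h0] at hs
      obtain ⟨h1, h2⟩ := hq.smul (1 - t)
      rw [abs_of_nonneg (by linarith [ht.2])] at h2
      have h3 := hmin _ _ h1 hs
      have h4 := mul_le_mul_of_nonneg_left h2 hα.le
      have h5 : objective α ud (fun x => (1 - t) * u x) (fun x => (1 - t) * q x)
          = 1 / 2 * l2norm (fun x => u x + t * (-1 * u x) - ud x) ^ 2
            + α * tv (fun x => (1 - t) * q x) := by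
        have e : (fun x => u x + t * (-1 * u x) - ud x) = fun x => (1 - t) * u x - ud x := by
          funext x; ring
        rw [e]; rfl
      have h6 : objective α ud u q = 1 / 2 * l2norm (fun x => u x - ud x) ^ 2 + α * tv q := rfl
      rw [h5, h6] at h3
      nlinarith
    rw [l2pair_const_mul_left, hgrad q u du hdu hsu] at key
    linarith

/-- Bounds for the multiplier. -/
lemma multiplier_bounds {α : ℝ} (hα : 0 < α) {z : ℝ → ℝ} (hz : Integrable z lebΩ)
    (h : ∀ p, MemBV p → 0 ≤ l2pair p z + α * tv p) :
    prim z 1 = 0 ∧ ∀ x ∈ Set.Icc (0 : ℝ) 1, |prim z x| ≤ α := by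
  -- Constants of both signs have no variation, which forces `z` to have mean zero.
  have h1 : prim z 1 = 0 := by
    have e : ∀ c : ℝ, 0 ≤ c * prim z 1 := fun c => by
      have := h _ (memBV_const c).1
      rwa [(memBV_const c).2, mul_zero, add_zero, l2pair, integral_const_mul, ← prim_one] at this
    linarith [e 1, e (-1)]
  refine ⟨h1, fun x hx => ?_⟩
  obtain ⟨h2, h3⟩ := memBV_indicator_Ioi hx
  have h4 := h _ h2
  obtain ⟨h5, h6⟩ := h2.smul (-1)
  have h7 := h _ h5
  rw [l2pair_const_mul_left] at h7
  rw [integral_indicator_Ioi hz hx, h1] at h4 h7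
  rw [abs_neg, abs_one, one_mul] at h6
  have h8 := mul_le_mul_of_nonneg_left h3 hα.le
  have h9 := mul_le_mul_of_nonneg_left (h6.trans h3) hα.le
  rw [abs_le]
  constructor <;> linarith

/-- Comparison with the zero control, whose discrete state is zero on every mesh; hence the bound is
independent of the mesh. -/
lemma IsDiscreteOptimal.tv_le {α : ℝ} (hα : 0 < α) {ud q u : ℝ → ℝ} {M : Mesh}
    (h : IsDiscreteOptimal α a d₀ ud M q u) : tv q ≤ l2norm ud ^ 2 / (2 * α) := by
  have h0 : IsH10 (fun _ => 0) (fun _ => 0) :=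
    isH10_of_ae_eq_prim (memLp_const 0) (by simp) 
      (Filter.Eventually.of_forall fun x => by simp [prim])
  have hs : IsDiscreteState a d₀ M (fun _ => 0) (fun _ => 0) :=
    ⟨fun _ => 0, ⟨h0, continuousOn_const, rfl, rfl, fun i => ⟨0, 0, by simp⟩⟩,
      fun w dw _ => by simp [bform, l2pair]⟩
  have h1 := h.minimal _ _ (memBV_const 0).1 hs
  have h2 : objective α ud (fun _ => 0) (fun _ => 0) = 1 / 2 * l2norm ud ^ 2 := by
    have e : (totalVar fun _ => 0).toReal = 0 := (memBV_const 0).2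
    rw [objective, e, l2norm_sub_comm]; simp
  rw [h2] at h1
  have h3 : objective α ud u q = 1 / 2 * l2norm (fun x => u x - ud x) ^ 2 + α * tv q := rfl
  rw [h3] at h1
  rw [le_div_iff₀ (by positivity)]
  nlinarith [sq_nonneg (l2norm (fun x => u x - ud x))]

end

/-! ### Quadratic growth of the multiplier -/

lemma integrable_of_continuousOn {f : ℝ → ℝ} (hf : ContinuousOn f (Set.Icc 0 1)) :
    Integrable f lebΩ := (memLp_top_of_continuousOn hf).top_to_two.to_integrable

lemma Ω_mem_nhds {x : ℝ} (hx : x ∈ Ω) : Ω ∈ nhds x := isOpen_Ioo.mem_nhds hx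

lemma hasDerivAt_prim_of_continuousOn {f : ℝ → ℝ} (hf : ContinuousOn f (Set.Icc 0 1)) {x : ℝ}
    (hx : x ∈ Ω) : HasDerivAt (prim f) (f x) x := by
  refine intervalIntegral.integral_hasDerivAt_right
    (intervalIntegrable_of_mem (integrable_of_continuousOn hf) zero_mem_Icc (Ω_subset_Icc hx)) ?_ ?_
  · exact (hf.mono Ω_subset_Icc).stronglyMeasurableAtFilter isOpen_Ioo x hx
  · exact (hf.mono Ω_subset_Icc).continuousAt (Ω_mem_nhds hx)

/-- At an interior maximum of Φ = prim f one has f(x₀) = 0, so Φ(x) = α + f'(x₀)(x - x₀)²/2 + o((x -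
x₀)²). The maximum forces f'(x₀) < 0. Differentiability of `f` at the single point x₀ suffices. -/
lemma exists_growth_at_max {f : ℝ → ℝ} (hf : ContinuousOn f (Set.Icc 0 1)) {α x₀ : ℝ}
    (hx₀ : x₀ ∈ Ω) (hα : prim f x₀ = α) (hle : ∀ x ∈ Set.Icc (0 : ℝ) 1, prim f x ≤ α)
    (hd : deriv f x₀ ≠ 0) :
    ∃ c, 0 < c ∧ ∀ᶠ x in nhds x₀, c * (x - x₀) ^ 2 ≤ α - prim f x := by
  set D := deriv f x₀ with hD
  have hDpos : 0 < |D| := abs_pos.2 hd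
  -- `deriv` is 0 at points of nondifferentiability, so a nonzero value already implies
  -- differentiability.
  have hdf : HasDerivAt f D x₀ := (differentiableAt_of_deriv_ne_zero hd).hasDerivAt
  have hf0 : f x₀ = 0 := by
    have hmax : IsLocalMax (prim f) x₀ := by
      filter_upwards [Ω_mem_nhds hx₀] with x hx
      rw [hα]; exact hle x (Ω_subset_Icc hx)
    exact hmax.hasDerivAt_eq_zero (hasDerivAt_prim_of_continuousOn hf hx₀)
  have hev : ∀ᶠ x in nhds x₀, |f x - D * (x - x₀)| ≤ |D| / 4 * |x - x₀| := by
    have := (hasDerivAt_iff_isLittleO.1 hdf).def (c := |D| / 4) (by positivity)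
    filter_upwards [this] with x hx
    simpa [hf0, mul_comm D] using hx
  obtain ⟨r, hr, hball⟩ := Metric.eventually_nhds_iff.1 (hev.and (Ω_mem_nhds hx₀))
  have hquad : ∀ x, |x - x₀| < r →
      |prim f x - α - D / 2 * (x - x₀) ^ 2| ≤ |D| / 4 * (x - x₀) ^ 2 := by
    intro x hx
    have hin : ∀ s ∈ Metric.closedBall x₀ |x - x₀|, |s - x₀| < r := fun s hs => by
      rw [Metric.mem_closedBall, Real.dist_eq] at hs; exact hs.trans_lt hx
    -- Mean value inequality on the ball of radius |x - x₀|, which integrates the linear remainder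
    -- of `f` to a quadratic one.
    have h := (convex_closedBall x₀ |x - x₀|).norm_image_sub_le_of_norm_hasDerivWithin_le
      (f := fun s => prim f s - D / 2 * (s - x₀) ^ 2) (f' := fun s => f s - D * (s - x₀))
      (C := |D| / 4 * |x - x₀|) (x := x₀) (y := x) (fun s hs => ?_) (fun s hs => ?_)
      (by simp) (by simp [Real.dist_eq])
    · have e : |D| / 4 * (x - x₀) ^ 2 = |D| / 4 * |x - x₀| * |x - x₀| := by
        rw [mul_assoc, abs_mul_abs_self]; ring
      simp only [sub_self, hα, Real.norm_eq_abs] at h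
      rw [e]
      refine le_trans (le_of_eq ?_) h
      congr 1; ring
    · have h1 := hasDerivAt_prim_of_continuousOn hf (hball (by rw [Real.dist_eq]; exact hin s hs)).2
      have h2 := ((((hasDerivAt_id s).sub_const x₀).pow 2).const_mul (D / 2))
      refine ((h1.sub h2).congr_deriv ?_).hasDerivWithinAt
      simp only [id, Nat.cast_ofNat]; ring
    · have h1 := (hball (y := s) (by rw [Real.dist_eq]; exact hin s hs)).1
      refine h1.trans (mul_le_mul_of_nonneg_left ?_ (by positivity))
      rwa [Metric.mem_closedBall, Real.dist_eq] at hs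
  have hDneg : D < 0 := by
    by_contra! hD0
    have hr2 : |x₀ + r / 2 - x₀| < r := by
      rw [add_sub_cancel_left, abs_of_pos (half_pos hr)]; exact half_lt_self hr
    have h1 := hquad _ hr2
    have h2 := hle _ (Ω_subset_Icc (hball (y := x₀ + r / 2) (by rw [Real.dist_eq]; exact hr2)).2)
    rw [abs_of_nonneg hD0, add_sub_cancel_left] at h1
    rw [abs_of_nonneg hD0] at hDpos
    have h3 := (abs_le.1 h1).1
    have : 0 < D * (r / 2) ^ 2 := by positivity
    linarith
  -- Half of |D| from the Taylor coefficient, minus the quarter lost to the remainder.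
  refine ⟨|D| / 4, by positivity, ?_⟩
  filter_upwards [Metric.ball_mem_nhds x₀ hr] with x hx
  have h1 := (abs_le.1 (hquad x (by rwa [Metric.mem_ball, Real.dist_eq] at hx))).2
  rw [abs_of_neg hDneg] at h1 ⊢
  linarith

lemma prim_neg (f : ℝ → ℝ) (x : ℝ) : prim (fun s => -f s) x = -prim f x := by
  simpa using prim_const_mul (-1) f x

lemma exists_growth_at_contact {z : ℝ → ℝ} (hz : ContinuousOn z (Set.Icc 0 1)) {α x₀ : ℝ}
    (hα0 : 0 < α) (hx₀ : x₀ ∈ Ω) (hα : |prim z x₀| = α)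
    (hle : ∀ x ∈ Set.Icc (0 : ℝ) 1, |prim z x| ≤ α) (hd : deriv z x₀ ≠ 0) :
    ∃ c, 0 < c ∧ ∀ᶠ x in nhds x₀, c * (x - x₀) ^ 2 ≤ α - |prim z x| := by
  have hcont := (hasDerivAt_prim_of_continuousOn hz hx₀).continuousAt
  rcases abs_eq hα0.le |>.1 hα with h | h
  · obtain ⟨c, hc, hev⟩ := exists_growth_at_max hz hx₀ h
      (fun x hx => (le_abs_self _).trans (hle x hx)) hd
    refine ⟨c, hc, ?_⟩
    filter_upwards [hev, hcont.eventually (lt_mem_nhds (by rw [h]; exact hα0))] with x h1 h2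
    rwa [abs_of_pos h2]
  · obtain ⟨c, hc, hev⟩ := exists_growth_at_max hz.fun_neg (α := α) hx₀ (by rw [prim_neg, h, neg_neg])
      (fun x hx => by rw [prim_neg]; exact (neg_le_abs _).trans (hle x hx))
      (by rw [deriv.fun_neg]; exact neg_ne_zero.2 hd)
    refine ⟨c, hc, ?_⟩
    filter_upwards [hev, hcont.eventually (eventually_lt_nhds (show prim z x₀ < 0 by rw [h]; linarith))] with x h1 h2
    rwa [abs_of_neg h2, ← prim_neg]

/-- Compactness glues local constants. The extra point 0 is a harmless reference for places where α
- |Φ| is bounded below, and it keeps the set nonempty when there is no contact. -/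
lemma exists_growth {z : ℝ → ℝ} (hz : ContinuousOn z (Set.Icc 0 1)) {α : ℝ} (hα : 0 < α)
    (h1 : prim z 1 = 0) (hle : ∀ x ∈ Set.Icc (0 : ℝ) 1, |prim z x| ≤ α)
    (hd : ∀ x ∈ contactSet α z, deriv z x ≠ 0) :
    ∃ c, 0 < c ∧ ∀ x ∈ Set.Icc (0 : ℝ) 1, ∃ y ∈ insert 0 (contactSet α z),
      c * (x - y) ^ 2 ≤ α - |prim z x| := by
  refine isCompact_Icc.induction_on (p := fun s => ∃ c, 0 < c ∧ ∀ x ∈ s,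
    ∃ y ∈ insert 0 (contactSet α z), c * (x - y) ^ 2 ≤ α - |prim z x|) ?_ ?_ ?_ ?_
  · exact ⟨1, one_pos, by simp⟩
  · rintro s t hst ⟨c, hc, h⟩
    exact ⟨c, hc, fun x hx => h x (hst hx)⟩
  · rintro s t ⟨c, hc, h⟩ ⟨c', hc', h'⟩
    refine ⟨min c c', lt_min hc hc', fun x hx => ?_⟩
    rcases hx with hx | hx
    · obtain ⟨y, hy, hxy⟩ := h x hx
      exact ⟨y, hy, (mul_le_mul_of_nonneg_right (min_le_left _ _) (sq_nonneg _)).trans hxy⟩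
    · obtain ⟨y, hy, hxy⟩ := h' x hx
      exact ⟨y, hy, (mul_le_mul_of_nonneg_right (min_le_right _ _) (sq_nonneg _)).trans hxy⟩
  · intro x₀ hx₀
    rcases (hle x₀ hx₀).lt_or_eq with hlt | heq
    · have hcont := (prim_continuousOn (integrable_of_continuousOn hz)).abs x₀ hx₀
      set m := (α - |prim z x₀|) / 2 with hm
      have hm0 : 0 < m := by rw [hm]; linarith
      have hev := hcont.eventually (gt_mem_nhds (show |prim z x₀| < α - m by rw [hm]; linarith))
      refine ⟨_, Filter.inter_mem hev self_mem_nhdsWithin, m, hm0, fun x hx => ⟨0, by simp, ?_⟩⟩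
      have h2 : |prim z x| < α - m := hx.1
      have h3 : (x - 0) ^ 2 ≤ 1 := by
        rw [sub_zero]; exact pow_le_one₀ hx.2.1 hx.2.2
      nlinarith
    -- Φ vanishes at both end points and α > 0, so contact happens in the interior only.
    · have hne0 : x₀ ≠ 0 := fun h => by rw [h, prim_zero, abs_zero] at heq; exact hα.ne heq
      have hne1 : x₀ ≠ 1 := fun h => by rw [h, h1, abs_zero] at heq; exact hα.ne heq
      have hΩ : x₀ ∈ Ω := ⟨lt_of_le_of_ne hx₀.1 hne0.symm, lt_of_le_of_ne hx₀.2 hne1⟩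
      have hX : x₀ ∈ contactSet α z := ⟨hΩ, heq⟩
      obtain ⟨c, hc, hev⟩ := exists_growth_at_contact hz hα hΩ heq hle (hd x₀ hX)
      exact ⟨_, mem_nhdsWithin_of_mem_nhds hev, c, hc,
        fun x hx => ⟨x₀, Set.mem_insert_of_mem _ hX, hx⟩⟩

/-! ### Distance to piecewise constant functions -/

lemma exists_mesh_of_finite {X : Set ℝ} (hX : X.Finite) (hΩ : X ⊆ Ω) :
    ∃ M : Mesh, ∀ y ∈ insert 0 X, ∃ j, M.node j = y := by
  classical
  -- The point 1/2 guarantees at least two cells, as `Mesh` requires, even when `X` is empty.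
  set Y : Finset ℝ := insert 0 (insert 1 (insert (1 / 2) hX.toFinset)) with hY
  have hcard : 3 ≤ Y.card := by
    have hsub : ({0, 1, 1 / 2} : Finset ℝ) ⊆ Y := by
      intro x hx
      simp only [Finset.mem_insert, Finset.mem_singleton] at hx
      rw [hY]
      rcases hx with rfl | rfl | rfl <;> simp
    have h3 : ({0, 1, 1 / 2} : Finset ℝ).card = 3 := by
      rw [Finset.card_insert_of_notMem, Finset.card_insert_of_notMem, Finset.card_singleton] <;> norm_num
    exact h3 ▸ Finset.card_le_card hsub
  have hYIcc : ∀ y ∈ Y, y ∈ Set.Icc (0 : ℝ) 1 := by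
    intro y hy
    simp only [hY, Finset.mem_insert, Set.Finite.mem_toFinset] at hy
    rcases hy with rfl | rfl | rfl | hy
    · simp
    · simp
    · norm_num
    · exact Ω_subset_Icc (hΩ hy)
  have hl : Y.card = (Y.card - 1) + 1 := by omega
  have h0Y : (0 : ℝ) ∈ Y := by simp [hY]
  have h1Y : (1 : ℝ) ∈ Y := by simp [hY]
  refine ⟨⟨Y.card - 1, by omega, Y.orderEmbOfFin hl, (Y.orderEmbOfFin hl).strictMono, ?_, ?_⟩, ?_⟩
  · have := Finset.orderEmbOfFin_zero hl (Nat.succ_pos _)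
    refine this.trans (le_antisymm (Finset.min'_le _ _ h0Y) ?_)
    exact (hYIcc _ (Finset.min'_mem _ _)).1
  · have := Finset.orderEmbOfFin_last hl (Nat.succ_pos _)
    refine this.trans (le_antisymm ?_ (Finset.le_max' _ _ h1Y))
    exact (hYIcc _ (Finset.max'_mem _ _)).2
  · intro y hy
    have hyY : y ∈ (Y : Set ℝ) := by
      rcases hy with rfl | hy
      · exact h0Y
      · simp [hY, hy]
    rwa [← Finset.range_orderEmbOfFin Y hl] at hyY

/-- Functions of bounded variation are close to their averages on a mesh that contains the contact
set, as measured by the first order optimality functional. -/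
lemma MemBV.integral_abs_sub_avg_le {q z : ℝ → ℝ} (hq : MemBV q) (hz : MemLp z 2 lebΩ)
    (h1 : prim z 1 = 0) {α c : ℝ} (hc : 0 < c) {M : Mesh}
    (hgrowth : ∀ x ∈ Set.Icc (0 : ℝ) 1, ∃ j, c * (x - M.node j) ^ 2 ≤ α - |prim z x|)
    {ε : ℝ} (hε : 0 < ε) :
    ∫ x, |q x - M.step (M.avg q) x| ∂lebΩ ≤ ε * tv q + (l2pair q z + α * tv q) / (c * ε) := by
  have hq2 := hq.memLp_two
  set r : ℝ → ℝ := fun x => q x - M.step (M.avg q) x with hr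
  have hr2 : MemLp r 2 lebΩ := hq2.sub (Mesh.memLp_step _).top_to_two
  let s : ℝ → ℝ := fun t => if 0 ≤ t then 1 else -1
  have hs : Measurable s := Measurable.ite measurableSet_Ici measurable_const measurable_const
  have hs1 : ∀ t, |s t| ≤ 1 := fun t => by simp only [s]; split_ifs <;> simp
  have hs2 : ∀ t, t * s t = |t| := fun t => by
    simp only [s]; split_ifs with h
    · rw [abs_of_nonneg h, mul_one]
    · rw [abs_of_neg (not_le.1 h), mul_neg_one]
  set g : ℝ → ℝ := fun x => s (r x) with hg
  have hg2 : MemLp g 2 lebΩ := (memLp_top_of_bound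
    (hs.comp_aemeasurable hr2.1.aemeasurable).aestronglyMeasurable 1
    (Filter.Eventually.of_forall fun x => hs1 _)).top_to_two
  have hgi := hg2.to_integrable
  set γ : ℝ → ℝ := fun x => g x - M.step (M.avg g) x with hγ
  have hPg2 : MemLp (M.step (M.avg g)) 2 lebΩ := (Mesh.memLp_step _).top_to_two
  have hγ2 : MemLp γ 2 lebΩ := hg2.sub hPg2
  have hγi := hγ2.to_integrable
  -- The L¹ norm is attained on the sign of `r`; by symmetry of averaging, the averaging passes from
  -- `q` to that sign function.
  have e1 : ∫ x, |r x| ∂lebΩ = l2pair q γ := by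
    have e : ∫ x, |r x| ∂lebΩ = l2pair r g := by
      rw [l2pair]; congr 1; funext x; exact (hs2 _).symm
    rw [e, hr, l2pair_sub_left hg2 hq2 (Mesh.memLp_step _).top_to_two,
      ← Mesh.l2pair_avg_comm hq.integrable hgi, ← l2pair_sub_right hq2 hg2 hPg2]
  have hγb : ∀ᵐ x ∂lebΩ, |γ x| ≤ 2 := by
    filter_upwards [M.ae_mem_cell] with x ⟨i, hi⟩
    rw [hγ]
    simp only [Mesh.step_apply _ hi]
    rw [abs_sub_comm]
    refine Mesh.abs_avg_sub_le hgi fun y _ => ?_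
    refine (abs_sub _ _).trans ?_
    have := hs1 (r y); have := hs1 (r x)
    simp only [hg]; linarith
  have hγ0 : ∫ x, γ x ∂lebΩ = 0 := by
    rw [hγ, integral_sub hgi hPg2.to_integrable, Mesh.integral_avg hgi, sub_self]
  -- With this `β`, the growth hypothesis bounds (x - node)²/ε by β(α - |Φ|). Subtracting β z from
  -- the dual function then leaves a primitive of size at most ε + βα, and the duality bound for `tv
  -- q` produces the claim.
  set β := 1 / (c * ε) with hβ
  have hβ0 : 0 < β := by positivity
  have hz' : MemLp (fun x => β * z x) 2 lebΩ := hz.const_mul β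
  have hmain := hq.l2pair_le_tv (g := fun x => γ x - β * z x) (c := ε + β * α) (hγ2.sub hz')
    (by rw [integral_sub hγi hz'.to_integrable, hγ0, integral_const_mul, ← prim_one, h1]; simp)
    fun x hx => by
      rw [prim_sub hγi hz'.to_integrable hx, prim_const_mul]
      obtain ⟨j, hj⟩ := hgrowth x hx
      have h2 := abs_prim_sub_prim_le hγi hγb (M.node_mem_Icc j) hx
      rw [Mesh.prim_node_eq_zero hγi (Mesh.integral_cell_sub_avg hgi), sub_zero] at h2
      have h3 : |prim γ x - β * prim z x| ≤ |prim γ x| + β * |prim z x| := by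
        refine (abs_sub _ _).trans ?_
        rw [abs_mul, abs_of_pos hβ0]
      -- Young's inequality with weight `ε`.
      have h4 : 2 * |x - M.node j| ≤ ε + (x - M.node j) ^ 2 / ε := by
        rw [← sub_le_iff_le_add', le_div_iff₀ hε, ← sq_abs (x - M.node j)]
        nlinarith [sq_nonneg (|x - M.node j| - ε)]
      have h5 : (x - M.node j) ^ 2 / ε ≤ β * (α - |prim z x|) := by
        have := mul_le_mul_of_nonneg_left hj hβ0.le
        refine le_trans (le_of_eq ?_) this
        rw [hβ]; field_simp
      linarith
  rw [l2pair_sub_right hq2 hγ2 hz', l2pair_const_mul_right] at hmain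
  rw [e1]
  have e2 : (l2pair q z + α * tv q) / (c * ε) = β * l2pair q z + β * α * tv q := by
    rw [hβ]; ring
  rw [e2]
  linarith

/-- If the first order optimality functional is nonpositive, the function is piecewise constant. -/
lemma MemBV.ae_eq_step {q z : ℝ → ℝ} (hq : MemBV q) (hz : MemLp z 2 lebΩ)
    (h1 : prim z 1 = 0) {α c : ℝ} (hc : 0 < c) {M : Mesh}
    (hgrowth : ∀ x ∈ Set.Icc (0 : ℝ) 1, ∃ j, c * (x - M.node j) ^ 2 ≤ α - |prim z x|)
    (hG : l2pair q z + α * tv q ≤ 0) : q =ᵐ[lebΩ] M.step (M.avg q) := by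
  have hi : Integrable (fun x => q x - M.step (M.avg q) x) lebΩ :=
    hq.integrable.sub (Mesh.memLp_step _).top_to_two.to_integrable
  have h0 : ∫ x, |q x - M.step (M.avg q) x| ∂lebΩ = 0 := by
    refine le_antisymm (le_of_forall_pos_le_add fun ε hε => ?_)
      (integral_nonneg fun x => abs_nonneg _)
    have ht := tv_nonneg q
    have hη : 0 < ε / (1 + tv q) := by positivity
    -- The term containing the functional is nonpositive for every weight, so the weight can be sent
    -- to 0.
    have h2 := hq.integral_abs_sub_avg_le hz h1 hc hgrowth hη
    have h3 : (l2pair q z + α * tv q) / (c * (ε / (1 + tv q))) ≤ 0 :=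
      div_nonpos_of_nonpos_of_nonneg hG (by positivity)
    have h4 : ε / (1 + tv q) * tv q ≤ ε := by
      rw [div_mul_eq_mul_div, div_le_iff₀ (by positivity)]; nlinarith
    linarith
  rw [integral_eq_zero_iff_of_nonneg (fun x => abs_nonneg _) hi.abs] at h0
  filter_upwards [h0] with x hx
  simpa [sub_eq_zero] using hx

/-! ### Error estimates -/

lemma abs_l2pair_le_of_bound {f g : ℝ → ℝ} (hf : Integrable f lebΩ) {B : ℝ}
    (hB : ∀ᵐ x ∂lebΩ, |g x| ≤ B) : |l2pair f g| ≤ B * ∫ x, |f x| ∂lebΩ := by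
  rw [l2pair, mul_comm, ← integral_mul_const]
  refine norm_integral_le_of_norm_le (f := fun x => f x * g x) (hf.abs.mul_const _) ?_
  filter_upwards [hB] with x hx
  rw [norm_mul]
  exact mul_le_mul_of_nonneg_left hx (norm_nonneg _)

lemma Mesh.integral_abs_step_le {M : Mesh} (c : Fin M.l → ℝ) :
    ∫ x, |M.step c x| ∂lebΩ ≤ ∑ i, |c i| := by
  rw [M.integral_eq_sum (memLp_step c).top_to_two.to_integrable.abs]
  refine Finset.sum_le_sum fun i _ => ?_
  have e : ∫ x in M.cell i, |M.step c x| = ∫ _ in M.cell i, |c i| :=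
    setIntegral_congr_fun measurableSet_Ioo fun x hx => by simp only [step_apply c hx]
  rw [e, integral_cell_const]
  have := M.len_le_width i
  exact mul_le_of_le_one_left (abs_nonneg _) (this.trans M.width_le_one)

section

variable {a d₀ : ℝ → ℝ} {K : ℝ≥0} {ν : ℝ}

/-- The cell averages of the control are controlled by the discrete state. -/
lemma IsElliptic.exists_integral_abs_le (h : IsElliptic a d₀ K ν) (M₀ : Mesh) :
    ∃ C, 0 ≤ C ∧ ∀ (M : Mesh) (p v : ℝ → ℝ), MemLp p 2 lebΩ → IsDiscreteState a d₀ M p v →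
      ∫ x, |p x| ∂lebΩ ≤ C * (∫ x, |p x - M₀.step (M₀.avg p) x| ∂lebΩ + l2norm v
        + M.width ^ 2 * ∫ x, |p x| ∂lebΩ) := by
  -- One fixed bump of unit mass per cell of `M₀`: pairing with it reads off the cell average. All
  -- constants below depend on these bumps, hence on `M₀` but not on `M`.
  have hψ : ∀ i : Fin M₀.l, ∃ ψ, IsTestFun ψ ∧ (∀ x, x ∉ M₀.cell i → ψ x = 0) ∧
      ∫ x, ψ x ∂lebΩ = 1 := fun i =>
    exists_bump (M₀.node_mem_Icc _).1 (M₀.node_lt i) (M₀.node_mem_Icc _).2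
  choose ψ hψ hψ0 hψ1 using hψ
  choose C₁ hC₁ hC₁b using fun i => h.exists_bform_test_le (hψ i)
  have hlip : ∀ i, ∃ L : ℝ≥0, LipschitzOnWith L (deriv (ψ i)) (Set.Icc 0 1) := fun i => by
    obtain ⟨L, hL⟩ := (hψ i).deriv_isTestFun.smooth.lipschitzWith_of_hasCompactSupport
      (hψ i).deriv_isTestFun.compact (by simp)
    exact ⟨L, hL.lipschitzOnWith⟩
  choose L hL using hlip
  choose C₂ hC₂ hC₂b using fun i => h.exists_ritz_le (hψ i).isH10 (hL i) (ae_eq_refl _)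
  choose C₃ hC₃ hC₃b using fun i => exists_bound_of_memLp_top (hψ i).memLp_top
  have hsum : ∀ i, 0 ≤ C₁ i + C₂ i + C₃ i := fun i => by
    have := hC₁ i; have := hC₂ i; have := hC₃ i; positivity
  refine ⟨1 + ∑ i, (C₁ i + C₂ i + C₃ i), by
    have := Finset.sum_nonneg fun i (_ : i ∈ Finset.univ) => hsum i
    positivity, fun M p v hp hv => ?_⟩
  obtain ⟨dv, hvFE, hvs⟩ := hv
  have hpi := hp.to_integrable
  have hP2 : MemLp (M₀.step (M₀.avg p)) 2 lebΩ := (Mesh.memLp_step _).top_to_two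
  have hr2 : MemLp (fun x => p x - M₀.step (M₀.avg p) x) 2 lebΩ := hp.sub hP2
  set R := ∫ x, |p x - M₀.step (M₀.avg p) x| ∂lebΩ with hR
  set δ := ∫ x, |p x| ∂lebΩ with hδ
  have hR0 : 0 ≤ R := integral_nonneg fun x => abs_nonneg _
  have hδ0 : 0 ≤ δ := integral_nonneg fun x => abs_nonneg _
  have hn := l2norm_nonneg v
  have hS : 0 ≤ R + l2norm v + M.width ^ 2 * δ := by positivity
  have havg : ∀ i, |M₀.avg p i| ≤ (C₁ i + C₂ i + C₃ i) * (R + l2norm v + M.width ^ 2 * δ) := by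
    intro i
    have e1 : M₀.avg p i = l2pair (M₀.step (M₀.avg p)) (ψ i) := by
      have : ∀ x, M₀.step (M₀.avg p) x * ψ i x = M₀.avg p i * ψ i x := fun x => by
        by_cases hx : x ∈ M₀.cell i
        · rw [Mesh.step_apply _ hx]
        · rw [hψ0 i x hx, mul_zero, mul_zero]
      rw [l2pair]
      simp_rw [this]
      rw [integral_const_mul, hψ1, mul_one]
    obtain ⟨yh, dyh, hy⟩ := h.exists_ritz M (hψ i).isH10
    have hyh := hy.isFE.isH10.memLp
    -- The discrete equation admits only finite element tests, hence the Ritz projection of the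
    -- bump; in the form against `v` it may be replaced by the bump itself.
    have e2 : l2pair p yh = bform a d₀ v dv (ψ i) (deriv (ψ i)) := by
      rw [← hvs _ _ hy.isFE, bform_comm, hy.eq _ _ hvFE, bform_comm]
    have e3 := l2pair_sub_left (hψ i).memLp_two hp hP2
    have e4 := l2pair_sub_right hp (hψ i).memLp_two hyh
    have b1 := hC₁b i v dv hvFE.isH10
    have b2 := abs_l2pair_le_of_bound hpi (hC₂b i M yh dyh hy)
    have b3 := abs_l2pair_le_of_bound hr2.to_integrable (hC₃b i)
    have e5 : M₀.avg p i = bform a d₀ v dv (ψ i) (deriv (ψ i)) + l2pair p (fun x => ψ i x - yh x)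
        - l2pair (fun x => p x - M₀.step (M₀.avg p) x) (ψ i) := by
      rw [e1, e3, e4, e2]; ring
    have b4 : |M₀.avg p i| ≤ C₁ i * l2norm v + C₂ i * M.width ^ 2 * δ + C₃ i * R := by
      rw [e5]
      exact (abs_sub _ _).trans (add_le_add ((abs_add_le _ _).trans (add_le_add b1 b2)) b3)
    have hH : 0 ≤ M.width ^ 2 * δ := by positivity
    have t1 := mul_le_mul_of_nonneg_left (show l2norm v ≤ R + l2norm v + M.width ^ 2 * δ by linarith) (hC₁ i)
    have t2 := mul_le_mul_of_nonneg_left (show M.width ^ 2 * δ ≤ R + l2norm v + M.width ^ 2 * δ by linarith) (hC₂ i)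
    have t3 := mul_le_mul_of_nonneg_left (show R ≤ R + l2norm v + M.width ^ 2 * δ by linarith) (hC₃ i)
    linarith
  have hstep : ∫ x, |M₀.step (M₀.avg p) x| ∂lebΩ
      ≤ (∑ i, (C₁ i + C₂ i + C₃ i)) * (R + l2norm v + M.width ^ 2 * δ) := by
    refine (Mesh.integral_abs_step_le _).trans ?_
    rw [Finset.sum_mul]
    exact Finset.sum_le_sum fun i _ => havg i
  have htri : δ ≤ R + ∫ x, |M₀.step (M₀.avg p) x| ∂lebΩ := by
    rw [hδ, hR, ← integral_add hr2.to_integrable.abs hP2.to_integrable.abs]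
    refine integral_mono hpi.abs (hr2.to_integrable.abs.add hP2.to_integrable.abs) fun x => ?_
    simpa using abs_add_le (p x - M₀.step (M₀.avg p) x) (M₀.step (M₀.avg p) x)
  have hH : 0 ≤ M.width ^ 2 * δ := by positivity
  rw [add_mul, one_mul]
  linarith

/-- The discrete error is controlled by the `L¹` error of the controls. -/
lemma IsElliptic.exists_energy_le (h : IsElliptic a d₀ K ν) {α : ℝ} (hα : 0 < α)
    {ud q u z dz : ℝ → ℝ} (hud : MemLp ud ⊤ lebΩ) (hq : MemBV q) (hqtop : MemLp q ⊤ lebΩ)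
    (hu : IsState a d₀ q u) (hz : IsH10 z dz)
    (hadj : ∀ w dw, IsH10 w dw → bform a d₀ w dw z dz = l2pair w (fun x => u x - ud x))
    (hG : l2pair q z + α * tv q ≤ 0) :
    ∃ C, 0 ≤ C ∧ ∀ (M : Mesh) (qh uh : ℝ → ℝ), IsDiscreteOptimal α a d₀ ud M qh uh →
      ∃ v, IsDiscreteState a d₀ M (fun x => qh x - q x) v ∧
        l2norm (fun x => uh x - u x) ≤ l2norm v + C * M.width ^ 2 ∧
        l2pair qh z + α * tv qh + l2norm v ^ 2
          ≤ C * M.width ^ 2 * (∫ x, |qh x - q x| ∂lebΩ + l2norm v) := by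
  obtain ⟨du, hu10, hus⟩ := hu
  have hud2 := hud.top_to_two
  -- Boundedness of `q` enters here: it gives the state the regularity that the Ritz estimate needs.
  obtain ⟨Lu, gu, hgu, hdu⟩ := h.exists_lip_deriv hu10 hqtop fun w dw hw => by
    rw [bform_comm, hus w dw hw, l2pair_comm]
  obtain ⟨Lz, gz, hgz, hdz⟩ := h.exists_lip_deriv hz (hu10.memLp_top.sub hud) hadj
  obtain ⟨Cu, hCu, hCub⟩ := h.exists_ritz_le hu10 hgu hdu
  obtain ⟨Cz, hCz, hCzb⟩ := h.exists_ritz_le hz hgz hdz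
  refine ⟨Cu + Cz, by positivity, fun M qh uh hopt => ?_⟩
  obtain ⟨duh, huh, huhs⟩ := hopt.state
  obtain ⟨ut, dut, hut⟩ := h.exists_ritz M hu10
  obtain ⟨zt, dzt, hzt⟩ := h.exists_ritz M hz
  have huh2 := huh.isH10.memLp
  have hut2 := hut.isFE.isH10.memLp
  have hzt2 := hzt.isFE.isH10.memLp
  -- By symmetry of the form, the discrete adjoint state is the discrete state of the residual `uh -
  -- ud`.
  obtain ⟨zh, dzh, hzh, hzhs⟩ := h.exists_discreteState M (huh2.sub hud2).to_integrable
  have hzh2 := hzh.isH10.memLp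
  obtain ⟨hD1, hD2⟩ := h.first_order (A := IsFE M) (fun _ _ hw => hw.isH10)
    (fun _ _ _ _ hv hw t => hv.add_smul hw t) (fun p hp => h.exists_discreteState M hp) hα hud2
    hopt.memBV hopt.state hopt.minimal hzh
    (fun w dw hw => by rw [bform_comm, hzhs w dw hw, l2pair_comm]; rfl)
  have hq2 := hq.memLp_two
  have hqh2 := hopt.memBV.memLp_two
  set p : ℝ → ℝ := fun x => qh x - q x with hp
  have hp2 : MemLp p 2 lebΩ := hqh2.sub hq2
  set v : ℝ → ℝ := fun x => uh x + (-1) * ut x with hv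
  set dv : ℝ → ℝ := fun x => duh x + (-1) * dut x with hdv
  have hvFE : IsFE M v dv := huh.add_smul hut.isFE (-1)
  have hv2 := hvFE.isH10.memLp
  have hvs : ∀ w dw, IsFE M w dw → bform a d₀ v dv w dw = l2pair p w := by
    intro w dw hw
    have hw2 := hw.isH10.memLp
    rw [hv, hdv, bform_add_left h hw2 hw.isH10.memLp_deriv huh2 huh.isH10.memLp_deriv
      (hut2.const_mul _) (hut.isFE.isH10.memLp_deriv.const_mul _), bform_smul_left, huhs w dw hw,
      hut.eq w dw hw, hus w dw hw.isH10, hp, l2pair_sub_left hw2 hqh2 hq2]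
    ring
  set H := M.width with hH
  have hH0 : 0 < H := M.width_pos
  set e := l2norm v with he
  have he0 : 0 ≤ e := l2norm_nonneg v
  have hut_err : l2norm (fun x => u x - ut x) ≤ Cu * H ^ 2 :=
    l2norm_le_of_bound (by positivity) (hCub M ut dut hut)
  have hCz' : 0 ≤ Cz * H ^ 2 := by positivity
  have hutu2 : MemLp (fun x => u x - ut x) 2 lebΩ := hu10.memLp.sub hut2
  refine ⟨v, ⟨dv, hvFE, hvs⟩, ?_, ?_⟩
  · have h1 := l2norm_add_le hv2 (hut2.sub hu10.memLp)
    have e1 : (fun x => v x + (ut - u) x) = fun x => uh x - u x := by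
      funext x; simp only [hv, Pi.sub_apply]; ring
    have e2 : l2norm (ut - u) = l2norm (fun x => u x - ut x) := l2norm_sub_comm ut u
    rw [e1, e2] at h1
    linarith
  -- The sum of three inequalities: the discrete functional is nonnegative at `q` and nonpositive at
  -- `qh`, and the continuous one is nonpositive at `q`.
  · have h1 : l2pair qh z + α * tv qh ≤ l2pair p (fun x => z x - zh x) := by
      have := hD1 q hq
      have hzz : MemLp (fun x => z x - zh x) 2 lebΩ := hz.memLp.sub hzh2
      rw [hp, l2pair_sub_left hzz hqh2 hq2, l2pair_sub_right hqh2 hz.memLp hzh2,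
        l2pair_sub_right hq2 hz.memLp hzh2]
      linarith
    have h2 : l2pair p (fun x => z x - zh x)
        = l2pair p (fun x => z x - zt x) + (l2pair p zt - l2pair p zh) := by
      rw [l2pair_sub_right hp2 hz.memLp hzh2, l2pair_sub_right hp2 hz.memLp hzt2]; ring
    have h3 : l2pair p zt = l2pair v (fun x => u x - ud x) := by
      rw [← hvs _ _ hzt.isFE, bform_comm, hzt.eq _ _ hvFE, bform_comm, hadj _ _ hvFE.isH10]
    have h4 : l2pair p zh = l2pair v (fun x => uh x - ud x) := by
      rw [← hvs _ _ hzh, bform_comm, hzhs _ _ hvFE, l2pair_comm]; rfl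
    -- The two residuals differ by u - uh = (u - ut) - v, which produces the square of the norm of
    -- `v` with the favourable sign.
    have h5 : l2pair v (fun x => u x - ud x) - l2pair v (fun x => uh x - ud x)
        = l2pair v (fun x => u x - ut x) - e ^ 2 := by
      have m1 : MemLp (fun x => u x - ud x) 2 lebΩ := hu10.memLp.sub hud2
      have m2 : MemLp (fun x => uh x - ud x) 2 lebΩ := huh2.sub hud2
      rw [he, l2norm_sq hv2, ← l2pair_sub_right hv2 m1 m2,
        ← l2pair_sub_right hv2 hutu2 hv2]
      congr 1; funext x; simp only [hv]; ring
    have h6 := (le_abs_self _).trans (abs_l2pair_le hv2 hutu2)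
    have h7 := (le_abs_self _).trans
      (abs_l2pair_le_of_bound hp2.to_integrable (hCzb M zt dzt hzt))
    have h8 : e * l2norm (fun x => u x - ut x) ≤ e * (Cu * H ^ 2) :=
      mul_le_mul_of_nonneg_left hut_err he0
    have hδ0 : 0 ≤ ∫ x, |p x| ∂lebΩ := integral_nonneg fun x => abs_nonneg _
    have h9 : 0 ≤ Cu * H ^ 2 * ∫ x, |p x| ∂lebΩ := by positivity
    have h10 : 0 ≤ Cz * H ^ 2 * e := by positivity
    have h11 : (Cu + Cz) * H ^ 2 * (∫ x, |p x| ∂lebΩ + e)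
        = Cu * H ^ 2 * (∫ x, |p x| ∂lebΩ) + Cz * H ^ 2 * e + Cz * H ^ 2 * (∫ x, |p x| ∂lebΩ)
          + e * (Cu * H ^ 2) := by ring
    rw [h11]
    rw [h2, h3, h4, h5] at h1
    linarith

/-- The elementary inequality that turns the three basic estimates into the convergence rate. -/
lemma le_of_basic_estimates {A B c T H G W δ e : ℝ} (hA : 0 < A) (hB : 0 < B) (hc : 0 < c)
    (hT : 0 ≤ T) (hH : 0 < H) (hW : ∀ ε, 0 < ε → W ≤ ε * T + G / (c * ε))
    (hδ : δ ≤ A * (W + e)) (hG : G + e ^ 2 ≤ B * H ^ 2 * (δ + e)) :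
    e ≤ (B * (A + 1) + B * A * (B * A / c) * T + 1) * H ^ 2 := by
  -- This weight makes `c * ε = B * A * H ^ 2`, so that after multiplication by `B * A * H ^ 2` the
  -- term `G` appears with coefficient 1 and cancels.
  have h1 := hW (B * A / c * H ^ 2) (by positivity)
  have e1 : c * (B * A / c * H ^ 2) = B * A * H ^ 2 := by field_simp
  rw [e1] at h1
  have hk : 0 < B * H ^ 2 := by positivity
  have h2 : B * A * H ^ 2 * W ≤ B * A * H ^ 2 * (B * A / c * H ^ 2 * T) + G := by
    have h3 := mul_le_mul_of_nonneg_left h1 (show 0 ≤ B * A * H ^ 2 by positivity)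
    rwa [mul_add, mul_div_cancel₀ _ (by positivity)] at h3
  have h4 := mul_le_mul_of_nonneg_left hδ hk.le
  set m := B * A * (B * A / c) * T with hm
  have hm0 : 0 ≤ m := by positivity
  set b := B * (A + 1) with hb
  have hb0 : 0 < b := by positivity
  have h5 : e ^ 2 ≤ m * H ^ 2 * H ^ 2 + b * H ^ 2 * e := by
    rw [hm, hb]; nlinarith
  -- What remains is e² ≤ m H⁴ + b H² e; if e > (b + m + 1) H², then e (e - b H²) exceeds m H⁴.
  by_contra! hlt
  have hH2 : 0 < H ^ 2 := by positivity
  have h6 : (m + 1) * H ^ 2 < e - b * H ^ 2 := by linarith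
  have h7 : H ^ 2 ≤ (m + 1) * H ^ 2 := by nlinarith
  have h8 : (m + 1) * H ^ 2 < e := by nlinarith
  have h9 : (m + 1) * H ^ 2 * H ^ 2 < e * (e - b * H ^ 2) := by
    have hp : 0 < (m + 1) * H ^ 2 := by positivity
    nlinarith
  nlinarith

/-- The averaging error of a difference only sees the first function if the second is piecewise
constant. -/
lemma Mesh.integral_abs_sub_avg_congr {M : Mesh} {q p : ℝ → ℝ} (hq : Integrable q lebΩ)
    (hp : Integrable p lebΩ) (h : p =ᵐ[lebΩ] M.step (M.avg p)) :
    ∫ x, |(q x - p x) - M.step (M.avg fun x => q x - p x) x| ∂lebΩ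
      = ∫ x, |q x - M.step (M.avg q) x| ∂lebΩ := by
  refine integral_congr_ae ?_
  filter_upwards [h, M.ae_mem_cell] with x hx ⟨i, hi⟩
  rw [Mesh.step_apply _ hi] at hx
  rw [Mesh.step_apply _ hi, Mesh.step_apply _ hi]
  have : M.avg (fun x => q x - p x) i = M.avg q i - M.avg p i := by
    rw [avg, avg, avg, integral_sub (M.integrableOn_cell hq i) (M.integrableOn_cell hp i), mul_sub]
  rw [this, hx]
  congr 1; ring

end

end

end BVControl

/-! ### Assembly of the convergence rate -/

theorem mainTheorem1
    (α : ℝ) (hα : 0 < α)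
    (a d₀ u_d : ℝ → ℝ)
    (K : ℝ≥0) (ha_lip : LipschitzOnWith K a (Set.Icc 0 1))
    (ν : ℝ) (hν : 0 < ν) (ha_ge : ∀ x ∈ Set.Icc (0 : ℝ) 1, ν ≤ a x)
    (hd₀ : MemLp d₀ ⊤ BVControl.lebΩ) (hd₀_nonneg : ∀ᵐ x ∂BVControl.lebΩ, 0 ≤ d₀ x)
    (hu_d : MemLp u_d ⊤ BVControl.lebΩ)
    (qbar ubar zbar : ℝ → ℝ)
    (hopt : BVControl.IsOptimal α a d₀ u_d qbar ubar)
    (hadj : BVControl.IsAdjointState a d₀ u_d ubar zbar)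
    (hA3 : BVControl.StructuralAssumption α zbar) :
    ∃ C : ℝ, 0 < C ∧ ∃ h₀ : ℝ, 0 < h₀ ∧
      ∀ M : BVControl.Mesh, M.width ≤ h₀ →
        ∀ q_h u_h : ℝ → ℝ, BVControl.IsDiscreteOptimal α a d₀ u_d M q_h u_h →
          BVControl.l2norm (fun x => u_h x - ubar x) ≤ C * M.width ^ 2 := by
  have hE : BVControl.IsElliptic a d₀ K ν := ⟨ha_lip, hν, ha_ge, hd₀, hd₀_nonneg⟩
  obtain ⟨hzc, dz, hz, hadj⟩ := hadj
  have hz2 := hz.memLp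
  obtain ⟨hB, hG⟩ := hE.first_order (A := BVControl.IsH10) (fun _ _ hw => hw)
    (fun _ _ _ _ hv hw t => hv.add_smul hw t) (fun p hp => hE.exists_state hp) hα hu_d.top_to_two
    hopt.memBV hopt.state hopt.minimal hz hadj
  obtain ⟨hz1, hzle⟩ := BVControl.multiplier_bounds hα (BVControl.integrable_of_continuousOn hzc) hB
  obtain ⟨c, hc, hgrowth⟩ := BVControl.exists_growth hzc hα hz1 hzle hA3.deriv_ne_zero
  obtain ⟨M₀, hM₀⟩ := BVControl.exists_mesh_of_finite hA3.finite fun x hx => hx.1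
  have hgrowth' : ∀ x ∈ Set.Icc (0 : ℝ) 1, ∃ j,
      c * (x - M₀.node j) ^ 2 ≤ α - |BVControl.prim zbar x| := fun x hx => by
    obtain ⟨y, hy, hxy⟩ := hgrowth x hx
    obtain ⟨j, rfl⟩ := hM₀ y hy
    exact ⟨j, hxy⟩
  -- The optimal control is piecewise constant on `M₀`, hence bounded.
  have hqstep := hopt.memBV.ae_eq_step hz2 hz1 hc hgrowth' hG
  have hqtop : MemLp qbar ⊤ BVControl.lebΩ :=
    (BVControl.Mesh.memLp_step (M₀.avg qbar)).ae_eq hqstep.symm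
  obtain ⟨C₁, hC₁, hL1⟩ := hE.exists_integral_abs_le M₀
  obtain ⟨C₂, hC₂, henergy⟩ :=
    hE.exists_energy_le hα hu_d hopt.memBV hqtop hopt.state hz hadj hG
  set T := BVControl.l2norm u_d ^ 2 / (2 * α)
  have hT : 0 ≤ T := by positivity
  -- The factor 2 pays for absorbing the term with h² times the L¹ error; the summand 1 only ensures
  -- positivity.
  set A := 2 * C₁ + 1
  set B := C₂ + 1
  have hA0 : 0 < A := by positivity
  have hB0 : 0 < B := by positivity
  -- The added `C₂` accounts for the Ritz error of the state. The choice `1 / A`, together with mesh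
  -- width at most 1, gives the smallness of `C₁ * M.width ^ 2` needed for the absorption.
  refine ⟨(B * (A + 1) + B * A * (B * A / c) * T + 1) + C₂, by positivity, 1 / A, by positivity,
    fun M hM q_h u_h hM_opt => ?_⟩
  obtain ⟨v, hv, herr, hen⟩ := henergy M q_h u_h hM_opt
  have hqh := hM_opt.memBV
  have hH := M.width_pos
  have hn := BVControl.l2norm_nonneg v
  have hp : MemLp (fun x => q_h x - qbar x) 2 BVControl.lebΩ :=
    hqh.memLp_two.sub hopt.memBV.memLp_two
  have hδ := hL1 M _ v hp hv
  -- Since q̄ equals its averages, the averaging error of the difference is that of `q_h`, to which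
  -- the core estimate applies.
  rw [BVControl.Mesh.integral_abs_sub_avg_congr hqh.integrable hopt.memBV.integrable hqstep] at hδ
  set δ := ∫ x, |q_h x - qbar x| ∂BVControl.lebΩ
  set W := ∫ x, |q_h x - M₀.step (M₀.avg q_h) x| ∂BVControl.lebΩ
  have hδ0 : 0 ≤ δ := integral_nonneg fun x => abs_nonneg _
  have hW0 : 0 ≤ W := integral_nonneg fun x => abs_nonneg _
  have hsmall : C₁ * M.width ^ 2 ≤ 1 / 2 := by
    have h1 : M.width * A ≤ 1 := (le_div_iff₀ hA0).1 hM
    have h2 := M.width_le_one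
    have h3 : M.width * (2 * C₁) ≤ 1 := by
      refine le_trans ?_ h1
      exact mul_le_mul_of_nonneg_left (by simp [A]) hH.le
    nlinarith [mul_nonneg hC₁ hH.le]
  have hδ' : δ ≤ A * (W + BVControl.l2norm v) := by
    have := mul_le_mul_of_nonneg_right hsmall hδ0
    simp only [A]
    nlinarith
  have hfinal := BVControl.le_of_basic_estimates hA0 hB0 hc hT hH
    (G := BVControl.l2pair q_h zbar + α * BVControl.tv q_h) (fun ε hε => by
      refine (hqh.integral_abs_sub_avg_le hz2 hz1 hc hgrowth' hε).trans ?_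
      exact add_le_add_left (mul_le_mul_of_nonneg_left (hM_opt.tv_le hα) hε.le) _) hδ' (by
      refine hen.trans (mul_le_mul_of_nonneg_right ?_ (by positivity))
      exact mul_le_mul_of_nonneg_right (by simp [B]) (by positivity))
  rw [add_mul]
  linarith
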